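/- **Setting (linear contextual bandit, adversarial contexts, oblivious adversary).** Let $d\ge 2$, $K\ge 1$, $T\ge 2$ be integers and let $\theta\in\mathbb R^d$ with $\|\theta\|\le 1$ be unknown to the learner. In round $t=1,\dots,T$ the learner first fixes a policy $\chi_t$, i.e. a map from $K$-tuples of context vectors to arms. Then she observes $x_{t1},\dots,x_{tK}\in\mathbb R^d$, plays $i_t=\chi_t(x_{t1},\dots,x_{tK})$ and receives $r_t=\theta^\top x_{t,i_t}+\varepsilon_t$. The tuples $(x_{ti})_{i\le K}$, $t\le T$, are independent over $t$ with arbitrary laws such that $\|x_{ti}\|\le 1$ almost surely; the noises $\varepsilon_1,\dots,\varepsilon_T$ are independent, sub-Gaussian with variance proxy $1$, and independent of the contexts. The number of policy switches is $1+\#\{2\le t\le T:\chi_t\ne\chi_{t-1}\}$, and the (random) regret is $R=\sum_{t=1}^T\big(\max_{i}x_{ti}^\top\theta-x_{t,i_t}^\top\theta\big)$. Write $\log=\log_2$. **Algorithm (RarelySwitch-SupLinUCB), with parameters $\delta\in(0,1)$ and $C\ge 2$.** Put $\kappa_0=\lceil\log d\rceil$, $\alpha_0=2\sqrt{d\ln(2T/\delta)}$,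 $\alpha_\kappa=10\sqrt{\ln(2dKT/\delta)}$ for $1\le\kappa\le\kappa_0$, and $\varpi_\kappa=2^{-\kappa}d^{3/2}/\sqrt T$ for $0\le\kappa\le\kappa_0$. Start with $\Lambda_{\kappa,0}=I$, $\xi_{\kappa,0}=0$, $\zeta_\kappa=0$ for $0\le\kappa\le\kappa_0$. In round $t$: 1. For all $\kappa\le\kappa_0$ and all arms $i$ set $\hat r^{(\kappa)}_{ti}=x_{ti}^\top\Lambda_{\kappa,\zeta_\kappa}^{-1}\xi_{\kappa,\zeta_\kappa}$ and $\omega^{(\kappa)}_{ti}=\alpha_\kappa\sqrt{x_{ti}^\top\Lambda_{\kappa,\zeta_\kappa}^{-1}x_{ti}}$. Let $A^{(0)}_t=\{i:\hat r^{(0)}_{ti}+\omega^{(0)}_{ti}\ge\hat r^{(0)}_{tj}-\omega^{(0)}_{tj}\ \forall j\}$. 2. For $\kappa=0,1,\dots,\kappa_0$: if $\kappa=\kappa_0$, play any $i_t\in A_t^{(\kappa_0)}$, set $\kappa_t=\kappa_0$ and leave the loop. Otherwise, if $\omega^{(\kappa)}_{ti}\le\varpi_\kappa$ for all $i\in A_t^{(\kappa)}$,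 set $A_t^{(\kappa+1)}=\{i\in A_t^{(\kappa)}:\hat r^{(\kappa)}_{ti}\ge\max_{j\in A_t^{(\kappa)}}\hat r^{(\kappa)}_{tj}-2\varpi_\kappa\}$ and continue. Otherwise play $i_t\in\arg\max_{i\in A_t^{(\kappa)}}\omega^{(\kappa)}_{ti}$, set $\kappa_t=\kappa$ and leave the loop. 3. Set $\Lambda_{\kappa,t}=\Lambda_{\kappa,t-1}+x_{t,i_t}x_{t,i_t}^\top$, $\xi_{\kappa,t}=\xi_{\kappa,t-1}+r_tx_{t,i_t}$ for $\kappa=\kappa_t$; the other layers keep their values. Then, for every $\kappa\le\kappa_0$ with $\det\Lambda_{\kappa,t}\ge C\det\Lambda_{\kappa,\zeta_\kappa}$, set $\zeta_\kappa=t$. Ties in the $\arg\max$ are broken by a fixed rule depending only on the set of tied arms; the arm played in layer $\kappa_0$ is any fixed measurable function of the frozen statistics $(\Lambda_{\kappa,\zeta_\kappa},\xi_{\kappa,\zeta_\kappa})_\kappa$, the contexts of the round and the set $A_t^{(\kappa_0)}$. **Theorem.** There is a universal constant $c>0$ such that, for all $d\ge2$, $K\ge1$, $T\ge2$, $\delta\in(0,1)$,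 $C\ge2$, all selection rules and all bandit instances as above, with $$B=c\,C\sqrt{dT}\,\log d\,\log T\,\log(dKT/\delta):$$ * almost surely, the number of policy switches is at most $1+c\,\dfrac{d\,\log d\,\log T}{\log C}$ (the summand $1$ being the initial choice of a policy); * with probability at least $1-2\delta$ the regret satisfies $R\le B$; * the $(1-2\delta)$-high probability expected regret, $\sup_A\mathbb E[\mathbf 1_A R]$ over all events $A$ with $\Pr[A]\ge1-2\delta$, is at most $B$. -/

import Mathlib

open MeasureTheory ProbabilityTheory
open scoped ENNReal NNReal Matrix

noncomputable section

namespace SupLin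

/-- Context vectors live in Euclidean space `ℝ^d`. -/
abbrev Vec (d : ℕ) := EuclideanSpace ℝ (Fin d)

/-- The `K` context vectors shown in one round, one for each arm. -/
abbrev Contexts (d K : ℕ) := Fin K → Vec d

/-- The statistics `(Λ, ξ)` of one layer: information matrix and reward-weighted sum of contexts. -/
abbrev Stat (d : ℕ) := Matrix (Fin d) (Fin d) ℝ × (Fin d → ℝ)

/-- The statistics of all layers; only the layers `0, …, κ₀` are ever used. -/
abbrev Stats (d : ℕ) := ℕ → Stat d

/-- The choices that the pseudocode leaves open: how ties in an `argmax` are broken, and which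
arm of the surviving set is played in the last layer. The latter may depend on everything that
determines the current policy, and on the contexts of the round. -/
structure SelectionRule (d K : ℕ) where
  tie : Finset (Fin K) → Fin K
  tie_mem : ∀ A : Finset (Fin K), A.Nonempty → tie A ∈ A
  last : Stats d → Contexts d K → Finset (Fin K) → Fin K
  last_mem : ∀ (D : Stats d) (X : Contexts d K) (A : Finset (Fin K)), A.Nonempty → last D X A ∈ A
  last_measurable : ∀ A : Finset (Fin K),
    Measurable fun p : (ℕ → (Fin d → Fin d → ℝ) × (Fin d → ℝ)) × Contexts d K =>
      last p.1 p.2 A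

/-- `κ₀ = ⌈log₂ d⌉`. -/
def lastLayer (d : ℕ) : ℕ := ⌈Real.logb 2 d⌉₊

/-- The confidence multipliers `α_κ`. -/
def alpha (d K T : ℕ) (δ : ℝ) : ℕ → ℝ
  | 0 => 2 * √(d * Real.log (2 * T / δ))
  | _ + 1 => 10 * √(Real.log (2 * d * K * T / δ))

/-- The target accuracies `ϖ_κ`. -/
def accuracy (d T : ℕ) : ℕ → ℝ
  | 0 => (d : ℝ) ^ (3 / 2 : ℝ) / √T
  | κ + 1 => accuracy d T κ / 2

/-- The estimated mean reward `xᵀ Λ⁻¹ ξ` of the context vector `x`. -/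
def estimate {d : ℕ} (S : Stat d) (x : Vec d) : ℝ := x.ofLp ⬝ᵥ (S.1⁻¹ *ᵥ S.2)

/-- `√(xᵀ Λ⁻¹ x)`. -/
def ellNorm {d : ℕ} (S : Stat d) (x : Vec d) : ℝ := √(x.ofLp ⬝ᵥ (S.1⁻¹ *ᵥ x.ofLp))

section Round

/- One round, played with the statistics `D κ = (Λ_{κ,ζ_κ}, ξ_{κ,ζ_κ})` and the contexts `X`. -/

variable {d K : ℕ} (T : ℕ) (δ : ℝ) (D : Stats d) (X : Contexts d K)

/-- The estimate of the reward of arm `i` in layer `κ`. -/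
def rhat (κ : ℕ) (i : Fin K) : ℝ := estimate (D κ) (X i)

/-- The confidence width of arm `i` in layer `κ`. -/
def width (κ : ℕ) (i : Fin K) : ℝ := alpha d K T δ κ * ellNorm (D κ) (X i)

open scoped Classical in
/-- The set `A^(κ)` of arms that survive up to layer `κ`. -/
def active : ℕ → Finset (Fin K)
  | 0 => Finset.univ.filter fun i =>
      ∀ j, rhat D X 0 j - width T δ D X 0 j ≤ rhat D X 0 i + width T δ D X 0 i
  | κ + 1 => (active κ).filter fun i =>
      ∀ j ∈ active κ, rhat D X κ j - 2 * accuracy d T κ ≤ rhat D X κ i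

/-- The loop over the layers stops at `κ` if `κ = κ₀`, or if some active arm is too uncertain. -/
def Stops (κ : ℕ) : Prop :=
  κ = lastLayer d ∨ ∃ i ∈ active T δ D X κ, accuracy d T κ < width T δ D X κ i

open scoped Classical in
/-- The layer `κ_t` to which the round is assigned: the first one at which the loop stops. -/
def layer : ℕ := Nat.find (p := Stops T δ D X) ⟨lastLayer d, Or.inl rfl⟩

open scoped Classical in
/-- The arms of `A^(κ)` of largest width in layer `κ`. -/
def widest (κ : ℕ) : Finset (Fin K) :=
  (active T δ D X κ).filter fun i =>
    ∀ j ∈ active T δ D X κ, width T δ D X κ j ≤ width T δ D X κ i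

/-- The policy of the learner while the frozen statistics are `D`: it maps the contexts `X` of
a round to the arm that is played. -/
def policy (rule : SelectionRule d K) : Fin K :=
  if layer T δ D X = lastLayer d then rule.last D X (active T δ D X (lastLayer d))
  else rule.tie (widest T δ D X (layer T δ D X))

end Round

/-- The memory of the learner: `cur κ = (Λ_{κ,t}, ξ_{κ,t})` and `frozen κ = (Λ_{κ,ζ_κ}, ξ_{κ,ζ_κ})`. -/
structure State (d : ℕ) where
  cur : Stats d
  frozen : Stats d

/-- Initially `Λ = I`, `ξ = 0`, `ζ = 0` in each layer. -/
def initState (d : ℕ) : State d := ⟨fun _ => (1, 0), fun _ => (1, 0)⟩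

open scoped Classical in
/-- The update at the end of a round with contexts `X` in which arm `i` was played, in layer `κ`,
and reward `r` was received: `Λ_κ` and `ξ_κ` are updated, and then each layer
whose determinant has grown by a factor of at least `C` since it was last frozen is frozen anew. -/
def update {d K : ℕ} (C : ℝ) (s : State d) (X : Contexts d K) (κ : ℕ) (i : Fin K) (r : ℝ) :
    State d :=
  let x : Fin d → ℝ := (X i).ofLp
  let cur' : Stats d :=
    Function.update s.cur κ ((s.cur κ).1 + Matrix.vecMulVec x x, (s.cur κ).2 + r • x)
  ⟨cur', fun j => if C * (s.frozen j).1.det ≤ (cur' j).1.det then cur' j else s.frozen j⟩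

section Run

/- Rounds are numbered `0, …, T - 1`; `x t` are the contexts and `ε t` is the noise of round `t`. -/

variable {d K : ℕ} (T : ℕ) (δ C : ℝ) (rule : SelectionRule d K) (θ : Vec d)
  (x : ℕ → Contexts d K) (ε : ℕ → ℝ)

/-- The memory of the learner after `t` rounds. The reward in a round in which arm `i` is played
is `⟨θ, x_{t,i}⟩ + ε_t`. -/
def run : ℕ → State d
  | 0 => initState d
  | t + 1 =>
      let s := run t
      let i := policy T δ s.frozen (x t) rule
      update C s (x t) (layer T δ s.frozen (x t)) i (inner ℝ θ (x t i) + ε t)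

/-- The policy used in round `t`. -/
def policyAt (t : ℕ) : Contexts d K → Fin K :=
  fun X => policy T δ (run T δ C rule θ x ε t).frozen X rule

open scoped Classical in
/-- The number of policy switches in `T` rounds; the initial choice of a policy counts as one. -/
def numSwitches : ℕ :=
  ((Finset.range T).filter fun t =>
    t = 0 ∨ policyAt T δ C rule θ x ε t ≠ policyAt T δ C rule θ x ε (t - 1)).card

/-- The cumulative regret `∑_t (max_i ⟨θ, x_{t,i}⟩ - ⟨θ, x_{t,i_t}⟩)` of the run. -/
def regret : ℝ :=
  ∑ t ∈ Finset.range T,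
    ((⨆ i : Fin K, inner ℝ θ (x t i)) - inner ℝ θ (x t (policyAt T δ C rule θ x ε t (x t))))

end Run

/-- The `(1 - η)`-high probability expected regret: the supremum of `𝔼[1_A R]` over all
events `A` of probability at least `1 - η`. -/
def highProbExpected {Ω : Type*} [MeasurableSpace Ω] (P : Measure Ω) (R : Ω → ℝ) (η : ℝ) : ℝ≥0∞ :=
  ⨆ (A : Set Ω) (_ : MeasurableSet A) (_ : ENNReal.ofReal (1 - η) ≤ P A),
    ∫⁻ ω in A, ENNReal.ofReal (R ω) ∂P

end SupLin

end

/-! Switches: the policy is a function of the frozen statistics, and every freezing of a layer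
multiplies its frozen determinant by at least `C`. This determinant starts at `1` and never exceeds
`T ^ d` (`det_info_le`), so each of the `κ₀ + 1` layers is frozen at most `d log T / log C` times
(`card_freezes_le`).

Regret while all confidence intervals hold: the best arm survives every elimination
(`best_mem_active`), and an arm that survives the test of layer `κ` has gap at most `4 ϖ_κ`. A round
that ends in a layer `κ < κ₀` does so because the width `ω` of the played arm exceeds `ϖ_κ`, which
turns its gap into at most `8 ω² / ϖ_κ` (`gap_le_of_layer_ne`). Using frozen instead of current
matrices costs a factor `C` (`quad_frozen_le`), and the squared elliptical norms telescope through
`log det` (`quad_info_le_log_det`). The ratio `α_κ² / ϖ_κ` is of order `√(T/d)` up to a logarithm in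
every layer, and a round of the last layer costs only `O(√(d/T))`.

Concentration: layer `0` uses the self-normalized bound from the method of mixtures, which pays a
factor `√d` in `α_0`. For `0 < κ < κ₀` the rounds assigned to layer `κ` and the arms played in them
depend on the estimates of lower layers and on the matrix of layer `κ`, but not on the rewards of
layer `κ`. Changing the noise of one such round therefore alters neither these choices nor the
matrix (`agreeUpTo_run`), so the error is a linear form in the noise whose coefficients behave as
constants, and `α_κ` needs no `√d`. Instead of conditioning, `lintegral_exp_sum_le_one` integrates
out the noises one coordinate at a time.

As the contexts are independent of the noise, they may be fixed by Fubini. The failure probability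
is at most `2δ/T`; since the regret never exceeds `2T`, failure adds at most `4δ` to its
expectation. -/

noncomputable section

namespace SupLin

/-! ### Inverse quadratic forms and determinants under rank-one updates -/

section QuadraticForm

variable {d : ℕ}

/-- The bilinear form `xᵀ A⁻¹ y`. -/
def quad (A : Matrix (Fin d) (Fin d) ℝ) (x y : Fin d → ℝ) : ℝ := x ⬝ᵥ (A⁻¹ *ᵥ y)

variable {A : Matrix (Fin d) (Fin d) ℝ}

lemma quad_one (x y : Fin d → ℝ) : quad 1 x y = x ⬝ᵥ y := by simp [quad]

lemma quad_add_left (x x' y : Fin d → ℝ) : quad A (x + x') y = quad A x y + quad A x' y := by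
  simp [quad, add_dotProduct]

lemma quad_add_right (x y y' : Fin d → ℝ) : quad A x (y + y') = quad A x y + quad A x y' := by
  simp [quad, Matrix.mulVec_add, dotProduct_add]

lemma quad_sub_right (x y y' : Fin d → ℝ) : quad A x (y - y') = quad A x y - quad A x y' := by
  simp [quad, Matrix.mulVec_sub, dotProduct_sub]

lemma quad_smul_left (c : ℝ) (x y : Fin d → ℝ) : quad A (c • x) y = c * quad A x y := by
  simp [quad]

lemma quad_smul_right (c : ℝ) (x y : Fin d → ℝ) : quad A x (c • y) = c * quad A x y := by
  simp [quad, Matrix.mulVec_smul]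

lemma quad_sum_right {ι : Type*} (s : Finset ι) (x : Fin d → ℝ) (y : ι → Fin d → ℝ) :
    quad A x (∑ i ∈ s, y i) = ∑ i ∈ s, quad A x (y i) := by
  classical
  induction s using Finset.induction_on with
  | empty => simp [quad]
  | insert i s hi ih => rw [Finset.sum_insert hi, Finset.sum_insert hi, quad_add_right, ih]

lemma quad_comm (hA : A.PosDef) (x y : Fin d → ℝ) : quad A x y = quad A y x := by
  have h : (A⁻¹)ᵀ = A⁻¹ := by simpa using hA.inv.isHermitian.eq
  unfold quad
  rw [Matrix.dotProduct_mulVec, ← Matrix.mulVec_transpose, h, dotProduct_comm]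

lemma quad_self_nonneg (hA : A.PosDef) (x : Fin d → ℝ) : 0 ≤ quad A x x := by
  simpa [quad] using hA.inv.posSemidef.dotProduct_mulVec_nonneg x

/-- Cauchy–Schwarz, from the discriminant of the nonnegative polynomial `t ↦ quad A (x + t y) (x + t
y)`. -/
lemma quad_sq_le (hA : A.PosDef) (x y : Fin d → ℝ) :
    quad A x y ^ 2 ≤ quad A x x * quad A y y := by
  have h : ∀ t : ℝ, 0 ≤ quad A y y * (t * t) + (2 * quad A x y) * t + quad A x x := by
    intro t
    have := quad_self_nonneg hA (x + t • y)
    simp only [quad_add_left, quad_add_right, quad_smul_left, quad_smul_right,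
      quad_comm hA y x] at this
    linarith
  have := discrim_le_zero h
  unfold discrim at this
  linarith

lemma abs_quad_le (hA : A.PosDef) (x y : Fin d → ℝ) :
    |quad A x y| ≤ √(quad A x x) * √(quad A y y) := by
  rw [← Real.sqrt_mul (quad_self_nonneg hA x)]
  exact Real.abs_le_sqrt (quad_sq_le hA x y)

lemma quad_mulVec (hA : A.PosDef) (x y : Fin d → ℝ) : quad A x (A *ᵥ y) = x ⬝ᵥ y := by
  have : IsUnit A.det := hA.det_pos.ne'.isUnit
  simp [quad, Matrix.mulVec_mulVec, Matrix.nonsing_inv_mul _ this]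

lemma posDef_add_vecMulVec (hA : A.PosDef) (y : Fin d → ℝ) :
    (A + Matrix.vecMulVec y y).PosDef :=
  hA.add_posSemidef (by simpa using Matrix.posSemidef_vecMulVec_self_star y)

lemma vecMulVec_mulVec_eq (y v : Fin d → ℝ) :
    Matrix.vecMulVec y y *ᵥ v = (y ⬝ᵥ v) • y := by
  ext i
  simp [Matrix.vecMulVec_mulVec, mul_comm]

lemma det_add_vecMulVec (hA : A.PosDef) (y : Fin d → ℝ) :
    (A + Matrix.vecMulVec y y).det = A.det * (1 + quad A y y) := by
  have hu : IsUnit A.det := hA.det_pos.ne'.isUnit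
  rw [Matrix.vecMulVec_eq Unit, Matrix.det_add_replicateCol_mul_replicateRow hu]
  congr 2
  simp only [Matrix.det_unique, quad, Matrix.dotProduct_mulVec]
  rfl

/-- The Sherman–Morrison formula. -/
lemma quad_add_vecMulVec (hA : A.PosDef) (y u v : Fin d → ℝ) :
    quad (A + Matrix.vecMulVec y y) u v =
      quad A u v - quad A u y * quad A y v / (1 + quad A y y) := by
  have hpos : 0 < 1 + quad A y y := by linarith [quad_self_nonneg hA y]
  have hu : IsUnit A.det := hA.det_pos.ne'.isUnit
  have hu' : IsUnit (A + Matrix.vecMulVec y y).det :=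
    (posDef_add_vecMulVec hA y).det_pos.ne'.isUnit
  have key : (A + Matrix.vecMulVec y y)⁻¹ *ᵥ v =
      A⁻¹ *ᵥ v - (quad A y v / (1 + quad A y y)) • (A⁻¹ *ᵥ y) := by
    have h1 : (A + Matrix.vecMulVec y y) *ᵥ
        (A⁻¹ *ᵥ v - (quad A y v / (1 + quad A y y)) • (A⁻¹ *ᵥ y)) = v := by
      rw [Matrix.add_mulVec, vecMulVec_mulVec_eq, Matrix.mulVec_sub, Matrix.mulVec_smul,
        Matrix.mulVec_mulVec, Matrix.mulVec_mulVec, Matrix.mul_nonsing_inv _ hu,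
        Matrix.one_mulVec, Matrix.one_mulVec, dotProduct_sub, dotProduct_smul]
      change v - (quad A y v / (1 + quad A y y)) • y +
        (quad A y v - (quad A y v / (1 + quad A y y)) • quad A y y) • y = v
      rw [sub_add, ← sub_smul, smul_eq_mul]
      have : quad A y v / (1 + quad A y y) - (quad A y v - quad A y v / (1 + quad A y y) *
          quad A y y) = 0 := by
        field_simp
        ring
      rw [this, zero_smul, sub_zero]
    conv_lhs => rw [← h1]
    rw [Matrix.mulVec_mulVec, Matrix.nonsing_inv_mul _ hu', Matrix.one_mulVec]
  unfold quad at key ⊢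
  rw [key, dotProduct_sub, dotProduct_smul, smul_eq_mul]
  ring

lemma quad_add_vecMulVec_le (hA : A.PosDef) (y x : Fin d → ℝ) :
    quad (A + Matrix.vecMulVec y y) x x ≤ quad A x x := by
  rw [quad_add_vecMulVec hA, quad_comm hA y x]
  have h1 : 0 < 1 + quad A y y := by linarith [quad_self_nonneg hA y]
  have h2 : 0 ≤ quad A x y * quad A x y / (1 + quad A y y) :=
    div_nonneg (mul_self_nonneg _) h1.le
  linarith

/-- By the determinant lemma and Sherman–Morrison the difference of the two sides is `det A` times
the Cauchy–Schwarz defect of `x` and `y`. This monotonicity bounds the cost of working with outdated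
matrices. -/
lemma det_mul_quad_le (hA : A.PosDef) (y x : Fin d → ℝ) :
    A.det * quad A x x ≤
      (A + Matrix.vecMulVec y y).det * quad (A + Matrix.vecMulVec y y) x x := by
  rw [quad_add_vecMulVec hA, quad_comm hA y x, det_add_vecMulVec hA, mul_assoc]
  have h1 : 0 < 1 + quad A y y := by linarith [quad_self_nonneg hA y]
  have h2 : (1 + quad A y y) * (quad A x x - quad A x y * quad A x y / (1 + quad A y y)) =
      quad A x x + (quad A x x * quad A y y - quad A x y ^ 2) := by
    field_simp
    ring
  rw [h2]
  exact mul_le_mul_of_nonneg_left (by linarith [quad_sq_le hA x y]) hA.det_pos.le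

/-- The determinant–trace inequality. -/
lemma det_le_trace_div_pow (hd : 0 < d) (hA : A.PosDef) : A.det ≤ (A.trace / d) ^ d := by
  have hH := hA.isHermitian
  have hd' : (0 : ℝ) < d := by exact_mod_cast hd
  rw [hH.det_eq_prod_eigenvalues, hH.trace_eq_sum_eigenvalues]
  have hn : ∀ i, 0 ≤ hH.eigenvalues i := fun i => (hA.eigenvalues_pos i).le
  have h := Real.geom_mean_le_arith_mean Finset.univ (fun _ : Fin d => (1 : ℝ))
    hH.eigenvalues (by simp) (by simpa using hd) (by simpa using hn)
  simp only [Real.rpow_one, Finset.sum_const, Finset.card_univ, Fintype.card_fin, nsmul_eq_mul,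
    mul_one, one_mul] at h
  have h0 : 0 ≤ ∏ i, hH.eigenvalues i := Finset.prod_nonneg fun i _ => hn i
  have h2 := pow_le_pow_left₀ (Real.rpow_nonneg h0 _) h d
  rw [← Real.rpow_natCast, ← Real.rpow_mul h0, inv_mul_cancel₀ hd'.ne', Real.rpow_one] at h2
  simpa using h2

end QuadraticForm

/-! ### Deterministic invariants of the run -/

section Run

variable {d K : ℕ} (T : ℕ) (δ C : ℝ) (rule : SelectionRule d K) (θ : Vec d)
  (x : ℕ → Contexts d K) (ε : ℕ → ℝ)

/-- The layer to which round `t` of the run is assigned. -/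
def layerAt (t : ℕ) : ℕ := layer T δ (run T δ C rule θ x ε t).frozen (x t)

/-- The context vector of the arm played in round `t`. -/
def played (t : ℕ) : Vec d := x t (policyAt T δ C rule θ x ε t (x t))

/-- The information matrix of layer `κ` after `t` rounds. -/
def info (κ t : ℕ) : Matrix (Fin d) (Fin d) ℝ := ((run T δ C rule θ x ε t).cur κ).1

/-- The noise part of the reward-weighted sum of contexts of layer `κ` after `t` rounds. -/
def noiseSum (κ t : ℕ) : Fin d → ℝ :=
  ∑ s ∈ Finset.range t, if layerAt T δ C rule θ x ε s = κ then
    ε s • (played T δ C rule θ x ε s).ofLp else 0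

lemma layer_le_lastLayer (D : Stats d) (X : Contexts d K) : layer T δ D X ≤ lastLayer d := by
  classical
  exact Nat.find_min' (p := Stops T δ D X) ⟨lastLayer d, Or.inl rfl⟩ (Or.inl rfl)

lemma stops_layer (D : Stats d) (X : Contexts d K) : Stops T δ D X (layer T δ D X) := by
  classical
  exact Nat.find_spec (p := Stops T δ D X) ⟨lastLayer d, Or.inl rfl⟩

lemma not_stops_of_lt_layer {D : Stats d} {X : Contexts d K} {κ : ℕ}
    (h : κ < layer T δ D X) : ¬ Stops T δ D X κ := by
  classical
  exact Nat.find_min (p := Stops T δ D X) ⟨lastLayer d, Or.inl rfl⟩ h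

lemma layer_eq_iff (D : Stats d) (X : Contexts d K) (κ : ℕ) :
    layer T δ D X = κ ↔ Stops T δ D X κ ∧ ∀ j < κ, ¬ Stops T δ D X j := by
  classical
  exact Nat.find_eq_iff (p := Stops T δ D X) ⟨lastLayer d, Or.inl rfl⟩

lemma cur_succ (t κ : ℕ) :
    (run T δ C rule θ x ε (t + 1)).cur κ =
      if layerAt T δ C rule θ x ε t = κ then
        (info T δ C rule θ x ε κ t + Matrix.vecMulVec (played T δ C rule θ x ε t).ofLp
            (played T δ C rule θ x ε t).ofLp,
          ((run T δ C rule θ x ε t).cur κ).2 +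
            (inner ℝ θ (played T δ C rule θ x ε t) + ε t) • (played T δ C rule θ x ε t).ofLp)
      else (run T δ C rule θ x ε t).cur κ := by
  split_ifs with h
  · subst h
    simp only [run, update, info, played, policyAt, layerAt, Function.update_self]
  · simp only [run, update]
    rw [Function.update_of_ne]
    exact fun h' => h h'.symm

lemma info_succ (t κ : ℕ) :
    info T δ C rule θ x ε κ (t + 1) =
      if layerAt T δ C rule θ x ε t = κ then
        info T δ C rule θ x ε κ t + Matrix.vecMulVec (played T δ C rule θ x ε t).ofLp
            (played T δ C rule θ x ε t).ofLp
      else info T δ C rule θ x ε κ t := by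
  unfold info
  rw [cur_succ]
  split_ifs <;> rfl

open scoped Classical in
lemma frozen_succ (t κ : ℕ) :
    (run T δ C rule θ x ε (t + 1)).frozen κ =
      if C * ((run T δ C rule θ x ε t).frozen κ).1.det ≤
          (info T δ C rule θ x ε κ (t + 1)).det then
        (run T δ C rule θ x ε (t + 1)).cur κ else (run T δ C rule θ x ε t).frozen κ := by
  rfl

lemma info_zero (κ : ℕ) : info T δ C rule θ x ε κ 0 = 1 := rfl

lemma noiseSum_succ (κ t : ℕ) :
    noiseSum T δ C rule θ x ε κ (t + 1) = noiseSum T δ C rule θ x ε κ t +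
      if layerAt T δ C rule θ x ε t = κ then
        ε t • (played T δ C rule θ x ε t).ofLp else 0 :=
  Finset.sum_range_succ _ _

lemma posDef_info (κ t : ℕ) : (info T δ C rule θ x ε κ t).PosDef := by
  induction t with
  | zero => exact Matrix.PosDef.one
  | succ t ih =>
    rw [info_succ]
    split_ifs
    · exact posDef_add_vecMulVec ih _
    · exact ih

lemma exists_frozen_eq_cur (κ t : ℕ) :
    ∃ s ≤ t, (run T δ C rule θ x ε t).frozen κ = (run T δ C rule θ x ε s).cur κ := by
  induction t with
  | zero => exact ⟨0, le_rfl, rfl⟩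
  | succ t ih =>
    rw [frozen_succ]
    split_ifs
    · exact ⟨t + 1, le_rfl, rfl⟩
    · obtain ⟨s, hs, h⟩ := ih
      exact ⟨s, by omega, h⟩

lemma posDef_frozen (κ t : ℕ) : ((run T δ C rule θ x ε t).frozen κ).1.PosDef := by
  obtain ⟨s, -, h⟩ := exists_frozen_eq_cur T δ C rule θ x ε κ t
  rw [h]
  exact posDef_info T δ C rule θ x ε κ s

/-- The freezing test restores this inequality after each round: either it failed, or both matrices
coincide and `C > 1`. -/
lemma det_info_lt (hC : 1 < C) (κ t : ℕ) :
    (info T δ C rule θ x ε κ t).det < C * ((run T δ C rule θ x ε t).frozen κ).1.det := by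
  cases t with
  | zero => simpa [info, run, initState] using hC
  | succ t =>
    rw [frozen_succ]
    split_ifs with h
    · have := (posDef_info T δ C rule θ x ε κ (t + 1)).det_pos
      change _ < C * (info T δ C rule θ x ε κ (t + 1)).det
      nlinarith
    · exact not_le.mp h

/-- Both sides agree at the moment of freezing, and afterwards the right one only grows, by
`det_mul_quad_le`. -/
lemma det_mul_quad_frozen_le (κ t : ℕ) (u : Fin d → ℝ) :
    ((run T δ C rule θ x ε t).frozen κ).1.det * quad ((run T δ C rule θ x ε t).frozen κ).1 u u ≤
      (info T δ C rule θ x ε κ t).det * quad (info T δ C rule θ x ε κ t) u u := by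
  induction t with
  | zero => exact le_rfl
  | succ t ih =>
    rw [frozen_succ]
    split_ifs with h
    · exact le_rfl
    · refine ih.trans ?_
      rw [info_succ]
      split_ifs
      · exact det_mul_quad_le (posDef_info T δ C rule θ x ε κ t) _ _
      · exact le_rfl

/-- Rare switching costs at most a factor of `C` in the squared confidence width. -/
lemma quad_frozen_le (hC : 1 < C) (κ t : ℕ) (u : Fin d → ℝ) :
    quad ((run T δ C rule θ x ε t).frozen κ).1 u u ≤
      C * quad (info T δ C rule θ x ε κ t) u u := by
  have h1 := det_mul_quad_frozen_le T δ C rule θ x ε κ t u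
  have h2 := det_info_lt T δ C rule θ x ε hC κ t
  have h3 := (posDef_frozen T δ C rule θ x ε κ t).det_pos
  have h4 := quad_self_nonneg (posDef_info T δ C rule θ x ε κ t) u
  refine le_of_mul_le_mul_left ?_ h3
  calc _ ≤ _ := h1
    _ ≤ (C * ((run T δ C rule θ x ε t).frozen κ).1.det) *
        quad (info T δ C rule θ x ε κ t) u u := mul_le_mul_of_nonneg_right h2.le h4
    _ = _ := by ring

lemma quad_info_le (κ t : ℕ) (u : Fin d → ℝ) :
    quad (info T δ C rule θ x ε κ t) u u ≤ u ⬝ᵥ u := by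
  induction t with
  | zero => rw [info_zero, quad_one]
  | succ t ih =>
    rw [info_succ]
    split_ifs
    · exact (quad_add_vecMulVec_le (posDef_info T δ C rule θ x ε κ t) _ _).trans ih
    · exact ih

lemma dotProduct_self_eq_norm_sq (v : Vec d) : v.ofLp ⬝ᵥ v.ofLp = ‖v‖ ^ 2 := by
  rw [EuclideanSpace.norm_sq_eq]
  simp [dotProduct, sq]

lemma dotProduct_eq_inner (v w : Vec d) : v.ofLp ⬝ᵥ w.ofLp = inner ℝ w v := by
  simp [dotProduct, PiLp.inner_apply]

lemma dotProduct_self_le_one {v : Vec d} (hv : ‖v‖ ≤ 1) : v.ofLp ⬝ᵥ v.ofLp ≤ 1 := by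
  rw [dotProduct_self_eq_norm_sq]
  exact pow_le_one₀ (norm_nonneg v) hv

lemma trace_info_le {n : ℕ} (hx : ∀ t < n, ∀ i, ‖x t i‖ ≤ 1) (κ t : ℕ) (ht : t ≤ n) :
    (info T δ C rule θ x ε κ t).trace ≤ d + t := by
  induction t with
  | zero => simp [info_zero]
  | succ t ih =>
    have ih := ih (by omega)
    rw [info_succ]
    push_cast
    split_ifs
    · rw [Matrix.trace_add, Matrix.trace_vecMulVec]
      have := dotProduct_self_le_one (v := played T δ C rule θ x ε t) (hx t (by omega) _)
      linarith
    · linarith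

lemma det_info_le (hd : 2 ≤ d) (hT : 2 ≤ T) (hx : ∀ t < T, ∀ i, ‖x t i‖ ≤ 1) (κ t : ℕ)
    (ht : t ≤ T) : (info T δ C rule θ x ε κ t).det ≤ (T : ℝ) ^ d := by
  have h1 := trace_info_le T δ C rule θ x ε hx κ t ht
  have hd' : (2 : ℝ) ≤ d := by exact_mod_cast hd
  have hT' : (2 : ℝ) ≤ T := by exact_mod_cast hT
  have ht' : (t : ℝ) ≤ T := by exact_mod_cast ht
  refine (det_le_trace_div_pow (by omega) (posDef_info T δ C rule θ x ε κ t)).trans ?_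
  refine pow_le_pow_left₀ (div_nonneg
    (posDef_info T δ C rule θ x ε κ t).posSemidef.trace_nonneg (by linarith)) ?_ d
  -- It remains to see `d + t ≤ T d`, which follows from `t ≤ T` and `(d - 1)(T - 1) ≥ 1`.
  rw [div_le_iff₀ (by linarith)]
  nlinarith

lemma one_le_det_info (κ t : ℕ) : 1 ≤ (info T δ C rule θ x ε κ t).det := by
  induction t with
  | zero => simp [info_zero]
  | succ t ih =>
    rw [info_succ]
    split_ifs
    · rw [det_add_vecMulVec (posDef_info T δ C rule θ x ε κ t)]
      nlinarith [quad_self_nonneg (posDef_info T δ C rule θ x ε κ t)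
        (played T δ C rule θ x ε t).ofLp]
    · exact ih

/-- The noiseless part of the rewards contributes `∑ x xᵀ θ = (Λ - 1) θ`; the missing `θ` is the
bias of the ridge regularization. -/
lemma cur_snd_eq (κ t : ℕ) :
    ((run T δ C rule θ x ε t).cur κ).2 =
      info T δ C rule θ x ε κ t *ᵥ θ.ofLp - θ.ofLp + noiseSum T δ C rule θ x ε κ t := by
  induction t with
  | zero => simp [run, initState, info, noiseSum]
  | succ t ih =>
    rw [cur_succ, info_succ, noiseSum_succ]
    split_ifs with h
    · simp only
      rw [ih, Matrix.add_mulVec, vecMulVec_mulVec_eq, add_smul, dotProduct_eq_inner]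
      abel
    · rw [ih, add_zero]

/-- The error of the ridge estimate. -/
lemma estimate_cur (κ t : ℕ) (v : Vec d) :
    estimate ((run T δ C rule θ x ε t).cur κ) v - inner ℝ θ v =
      quad (info T δ C rule θ x ε κ t) v.ofLp (noiseSum T δ C rule θ x ε κ t) -
        quad (info T δ C rule θ x ε κ t) v.ofLp θ.ofLp := by
  change quad (info T δ C rule θ x ε κ t) v.ofLp ((run T δ C rule θ x ε t).cur κ).2 - _ = _
  rw [cur_snd_eq, quad_add_right, quad_sub_right,
    quad_mulVec (posDef_info T δ C rule θ x ε κ t), dotProduct_eq_inner]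
  ring

lemma info_eq_sum (κ t : ℕ) :
    info T δ C rule θ x ε κ t = 1 + ∑ s ∈ Finset.range t,
      if layerAt T δ C rule θ x ε s = κ then
        Matrix.vecMulVec (played T δ C rule θ x ε s).ofLp (played T δ C rule θ x ε s).ofLp
      else 0 := by
  induction t with
  | zero => simp [info_zero]
  | succ t ih =>
    rw [info_succ, Finset.sum_range_succ, ← add_assoc, ← ih]
    split_ifs <;> simp

/-- With `w = Λ⁻¹ u` the sum is `wᵀ (Λ - 1) w ≤ wᵀ Λ w`. It is the variance proxy of the noise part
of the estimate in direction `u`. -/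
lemma sum_quad_sq_le (κ t : ℕ) (u : Fin d → ℝ) :
    ∑ s ∈ Finset.range t, (if layerAt T δ C rule θ x ε s = κ then
        quad (info T δ C rule θ x ε κ t) u (played T δ C rule θ x ε s).ofLp else 0) ^ 2 ≤
      quad (info T δ C rule θ x ε κ t) u u := by
  have hP := posDef_info T δ C rule θ x ε κ t
  set A := info T δ C rule θ x ε κ t with hA
  set w := A⁻¹ *ᵥ u with hw
  have hq : ∀ v, quad A u v = v ⬝ᵥ w := fun v => quad_comm hP u v
  have hAw : A *ᵥ w = u := by
    rw [hw, Matrix.mulVec_mulVec, Matrix.mul_nonsing_inv _ hP.det_pos.ne'.isUnit,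
      Matrix.one_mulVec]
  have h1 : quad A u u = w ⬝ᵥ (A *ᵥ w) := by rw [hAw, hq, dotProduct_comm]
  have h2 : A *ᵥ w = w + ∑ s ∈ Finset.range t, if layerAt T δ C rule θ x ε s = κ then
      ((played T δ C rule θ x ε s).ofLp ⬝ᵥ w) • (played T δ C rule θ x ε s).ofLp else 0 := by
    conv_lhs => rw [hA, info_eq_sum]
    rw [Matrix.add_mulVec, Matrix.one_mulVec, Matrix.sum_mulVec]
    congr 1
    refine Finset.sum_congr rfl fun s _ => ?_
    split_ifs
    · rw [vecMulVec_mulVec_eq]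
    · simp
  rw [h1, h2, dotProduct_add, dotProduct_sum]
  have h3 : 0 ≤ w ⬝ᵥ w := by
    simpa using dotProduct_star_self_nonneg w
  have h4 : ∀ s ∈ Finset.range t, (if layerAt T δ C rule θ x ε s = κ then
        quad A u (played T δ C rule θ x ε s).ofLp else 0) ^ 2 =
      w ⬝ᵥ (if layerAt T δ C rule θ x ε s = κ then
      ((played T δ C rule θ x ε s).ofLp ⬝ᵥ w) • (played T δ C rule θ x ε s).ofLp else 0) := by
    intro s _
    split_ifs
    · rw [hq, dotProduct_smul, dotProduct_comm w, smul_eq_mul, sq]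
    · simp
  rw [Finset.sum_congr rfl h4]
  linarith

/-! ### Counting policy switches -/

lemma info_eq_one_of_lastLayer_lt {κ : ℕ} (hκ : lastLayer d < κ) (t : ℕ) :
    info T δ C rule θ x ε κ t = 1 := by
  induction t with
  | zero => rfl
  | succ t ih =>
    rw [info_succ, if_neg, ih]
    exact ((layer_le_lastLayer T δ _ _).trans_lt hκ).ne

/-- Statistics are indexed by all of `ℕ`, so equality of two policies is derived from equality in
the unused layers too. Their determinant stays `1`, and `C > 1` makes the freezing test fail. -/
lemma frozen_succ_of_lastLayer_lt (hC : 1 < C) {κ : ℕ} (hκ : lastLayer d < κ) (t : ℕ) :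
    (run T δ C rule θ x ε (t + 1)).frozen κ = (run T δ C rule θ x ε t).frozen κ := by
  rw [frozen_succ, if_neg]
  have h1 := det_info_lt T δ C rule θ x ε hC κ t
  rw [info_eq_one_of_lastLayer_lt T δ C rule θ x ε hκ t] at h1
  rw [info_eq_one_of_lastLayer_lt T δ C rule θ x ε hκ]
  exact not_le.mpr h1

open scoped Classical in
/-- The rounds among the first `n` after which layer `κ` is frozen anew. -/
def freezes (κ n : ℕ) : Finset ℕ :=
  (Finset.range n).filter fun t =>
    (run T δ C rule θ x ε (t + 1)).frozen κ ≠ (run T δ C rule θ x ε t).frozen κ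

/-- A change of the frozen statistics means that the test succeeded, so the frozen determinant,
initially `1`, gained a factor of at least `C`. -/
lemma pow_card_freezes_le (hC : 1 < C) (κ n : ℕ) :
    C ^ (freezes T δ C rule θ x ε κ n).card ≤ ((run T δ C rule θ x ε n).frozen κ).1.det := by
  classical
  induction n with
  | zero =>
    have h : freezes T δ C rule θ x ε κ 0 = ∅ := rfl
    rw [h]
    simp [run, initState]
  | succ n ih =>
    unfold freezes at ih ⊢
    rw [Finset.range_add_one, Finset.filter_insert]
    split_ifs with h
    · rw [Finset.card_insert_of_notMem (by simp), pow_succ]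
      rw [frozen_succ] at h ⊢
      split_ifs at h ⊢ with h'
      · refine le_trans ?_ h'
        rw [mul_comm]
        exact mul_le_mul_of_nonneg_left ih (by linarith)
      · exact absurd rfl h
    · rw [not_not] at h
      rw [h]
      exact ih

lemma card_freezes_le (hd : 2 ≤ d) (hT : 2 ≤ T) (hC : 1 < C)
    (hx : ∀ t < T, ∀ i, ‖x t i‖ ≤ 1) (κ n : ℕ) (hn : n ≤ T) :
    ((freezes T δ C rule θ x ε κ n).card : ℝ) ≤ d * Real.logb 2 T / Real.logb 2 C := by
  have h1 := pow_card_freezes_le T δ C rule θ x ε hC κ n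
  obtain ⟨s, hs, h⟩ := exists_frozen_eq_cur T δ C rule θ x ε κ n
  rw [h] at h1
  have h2 := h1.trans (det_info_le T δ C rule θ x ε hd hT hx κ s (hs.trans hn))
  have hlogC : 0 < Real.logb 2 C := Real.logb_pos (by norm_num) hC
  rw [le_div_iff₀ hlogC]
  have h3 := Real.logb_le_logb_of_le (b := 2) (by norm_num) (by positivity) h2
  rwa [Real.logb_pow, Real.logb_pow] at h3

lemma lastLayer_le (hd : 2 ≤ d) : (lastLayer d : ℝ) ≤ 2 * Real.logb 2 d := by
  have h1 : 1 ≤ Real.logb 2 d := by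
    rw [Real.le_logb_iff_rpow_le (by norm_num) (by positivity)]
    simpa using hd
  have := Nat.ceil_lt_add_one (show 0 ≤ Real.logb 2 d by linarith)
  unfold lastLayer
  linarith

/-- A new policy in round `t + 1` forces some layer to be frozen at the end of round `t`. The
freezing after the last round affects no policy, hence `T - 1`. -/
lemma numSwitches_le_sum (hC : 1 < C) :
    numSwitches T δ C rule θ x ε ≤
      1 + ∑ κ ∈ Finset.range (lastLayer d + 1), (freezes T δ C rule θ x ε κ (T - 1)).card := by
  classical
  have hsub : ((Finset.range T).filter fun t => t = 0 ∨
      policyAt T δ C rule θ x ε t ≠ policyAt T δ C rule θ x ε (t - 1)) ⊆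
      {0} ∪ ((Finset.range (lastLayer d + 1)).biUnion fun κ =>
        freezes T δ C rule θ x ε κ (T - 1)).image (· + 1) := by
    intro t ht
    rw [Finset.mem_filter, Finset.mem_range] at ht
    rcases Nat.eq_zero_or_pos t with rfl | hpos
    · simp
    obtain ⟨t, rfl⟩ : ∃ s, t = s + 1 := ⟨t - 1, by omega⟩
    have hne : policyAt T δ C rule θ x ε (t + 1) ≠ policyAt T δ C rule θ x ε t := by
      rcases ht.2 with h | h
      · omega
      · simpa using h
    refine Finset.mem_union_right _ (Finset.mem_image.mpr ⟨t, ?_, rfl⟩)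
    rw [Finset.mem_biUnion]
    by_contra hcon
    push Not at hcon
    refine hne ?_
    have : (run T δ C rule θ x ε (t + 1)).frozen = (run T δ C rule θ x ε t).frozen := by
      funext κ
      by_cases hκ : κ ≤ lastLayer d
      · by_contra h
        exact hcon κ (by simpa [Nat.lt_succ_iff] using hκ)
          (by simpa [freezes] using ⟨by omega, h⟩)
      · exact frozen_succ_of_lastLayer_lt T δ C rule θ x ε hC (by omega) t
    unfold policyAt
    rw [this]
  unfold numSwitches
  refine (Finset.card_le_card hsub).trans ((Finset.card_union_le _ _).trans ?_)
  rw [Finset.card_singleton]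
  exact Nat.add_le_add_left (Finset.card_image_le.trans Finset.card_biUnion_le) 1

theorem numSwitches_le (hd : 2 ≤ d) (hT : 2 ≤ T) (hC : 1 < C)
    (hx : ∀ t < T, ∀ i, ‖x t i‖ ≤ 1) :
    (numSwitches T δ C rule θ x ε : ℝ) ≤
      1 + 3 * (d * Real.logb 2 d * Real.logb 2 T / Real.logb 2 C) := by
  have h1 : (numSwitches T δ C rule θ x ε : ℝ) ≤ 1 + ∑ κ ∈ Finset.range (lastLayer d + 1),
      ((freezes T δ C rule θ x ε κ (T - 1)).card : ℝ) := by
    exact_mod_cast numSwitches_le_sum T δ C rule θ x ε hC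
  have h2 := Finset.sum_le_sum fun κ (_ : κ ∈ Finset.range (lastLayer d + 1)) =>
    card_freezes_le T δ C rule θ x ε hd hT hC hx κ (T - 1) (by omega)
  rw [Finset.sum_const, Finset.card_range, nsmul_eq_mul] at h2
  have hlogC : 0 < Real.logb 2 C := Real.logb_pos (by norm_num) hC
  have hlogT : 0 ≤ Real.logb 2 T := Real.logb_nonneg (by norm_num) (by norm_cast; omega)
  have h3 : 1 ≤ Real.logb 2 d := by
    rw [Real.le_logb_iff_rpow_le (by norm_num) (by positivity)]
    simpa using hd
  have h4 : ((lastLayer d + 1 : ℕ) : ℝ) ≤ 3 * Real.logb 2 d := by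
    push_cast
    linarith [lastLayer_le hd]
  have h5 := mul_le_mul_of_nonneg_right h4
    (show 0 ≤ d * Real.logb 2 T / Real.logb 2 C by positivity)
  calc _ ≤ _ := h1
    _ ≤ 1 + 3 * Real.logb 2 d * (d * Real.logb 2 T / Real.logb 2 C) := by linarith
    _ = _ := by ring

end Run

/-! ### Gaps of the played arm within one round -/

section Round

variable {d K T : ℕ} {δ : ℝ} {D : Stats d} {X : Contexts d K} {θ : Vec d}

lemma width_eq (κ : ℕ) (i : Fin K) :
    width T δ D X κ i = alpha d K T δ κ * √(quad (D κ).1 (X i).ofLp (X i).ofLp) := rfl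

lemma widest_nonempty {κ : ℕ} (h : (active T δ D X κ).Nonempty) :
    (widest T δ D X κ).Nonempty := by
  obtain ⟨i, hi, hmax⟩ := Finset.exists_max_image _ (width T δ D X κ) h
  exact ⟨i, Finset.mem_filter.mpr ⟨hi, hmax⟩⟩

/-- All confidence intervals used by the policy are valid. -/
def Confident (T : ℕ) (δ : ℝ) (D : Stats d) (X : Contexts d K) (θ : Vec d) : Prop :=
  ∀ κ < lastLayer d, ∀ i, |rhat D X κ i - inner ℝ θ (X i)| ≤ width T δ D X κ i

lemma width_le_accuracy {κ : ℕ} (hκ : κ < layer T δ D X) {i : Fin K}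
    (hi : i ∈ active T δ D X κ) : width T δ D X κ i ≤ accuracy d T κ := by
  by_contra h
  exact not_stops_of_lt_layer T δ hκ (Or.inr ⟨i, hi, not_le.mp h⟩)

/-- In layer `0` overlapping valid intervals keep the best arm. Later, the loop having passed layer
`κ`, all active estimates are within `ϖ_κ` of the truth, so the best arm loses at most the tolerance
`2 ϖ_κ`. -/
lemma best_mem_active (hd : 0 < lastLayer d) (hconf : Confident T δ D X θ) {b : Fin K}
    (hb : ∀ j, inner ℝ θ (X j) ≤ inner ℝ θ (X b)) (κ : ℕ) (hκ : κ ≤ layer T δ D X) :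
    b ∈ active T δ D X κ := by
  induction κ with
  | zero =>
    refine Finset.mem_filter.mpr ⟨Finset.mem_univ _, fun j => ?_⟩
    have h1 := abs_le.mp (hconf 0 hd b)
    have h2 := abs_le.mp (hconf 0 hd j)
    linarith [hb j]
  | succ κ ih =>
    refine Finset.mem_filter.mpr ⟨ih (by omega), fun j hj => ?_⟩
    have hlt : κ < lastLayer d := lt_of_lt_of_le hκ (layer_le_lastLayer T δ D X)
    have h1 := abs_le.mp (hconf κ hlt b)
    have h2 := abs_le.mp (hconf κ hlt j)
    have h3 := width_le_accuracy hκ hj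
    have h4 := width_le_accuracy hκ (ih (by omega))
    linarith [hb j]

/-- The elimination rule allows `2 ϖ_κ`, and the two estimates are off by at most `ϖ_κ` each. -/
lemma gap_le_of_mem_active (hd : 0 < lastLayer d) (hconf : Confident T δ D X θ) {b : Fin K}
    (hb : ∀ j, inner ℝ θ (X j) ≤ inner ℝ θ (X b)) {κ : ℕ} (hκ : κ < layer T δ D X)
    {i : Fin K} (hi : i ∈ active T δ D X (κ + 1)) :
    inner ℝ θ (X b) - inner ℝ θ (X i) ≤ 4 * accuracy d T κ := by
  have hlt : κ < lastLayer d := lt_of_lt_of_le hκ (layer_le_lastLayer T δ D X)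
  have hbm := best_mem_active hd hconf hb κ hκ.le
  obtain ⟨hi', hi''⟩ := Finset.mem_filter.mp hi
  have h1 := abs_le.mp (hconf κ hlt b)
  have h2 := abs_le.mp (hconf κ hlt i)
  have h3 := width_le_accuracy hκ hbm
  have h4 := width_le_accuracy hκ hi'
  linarith [hi'' b hbm]

lemma policy_mem_active (rule : SelectionRule d K)
    (h : (active T δ D X (layer T δ D X)).Nonempty) :
    policy T δ D X rule ∈ active T δ D X (layer T δ D X) := by
  unfold policy
  split_ifs with hl
  · rw [hl] at h ⊢
    exact rule.last_mem _ _ _ h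
  · exact (Finset.mem_filter.mp (rule.tie_mem _ (widest_nonempty h))).1

lemma policy_mem_widest (rule : SelectionRule d K)
    (h : (active T δ D X (layer T δ D X)).Nonempty) (hl : layer T δ D X ≠ lastLayer d) :
    policy T δ D X rule ∈ widest T δ D X (layer T δ D X) := by
  unfold policy
  rw [if_neg hl]
  exact rule.tie_mem _ (widest_nonempty h)

lemma accuracy_pos (hd : 0 < d) (hT : 0 < T) (κ : ℕ) : 0 < accuracy d T κ := by
  induction κ with
  | zero => unfold accuracy; positivity
  | succ κ ih => unfold accuracy; linarith

/-- The played arm is the widest active one, so its width `ω` exceeds `ϖ_κ`. A gap of at most `8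
ϖ_κ`, or `4 ω` in layer `0`, is thereby converted into a multiple of `ω²`, the quantity that can be
summed over time. -/
lemma gap_le_of_layer_ne (hd : 0 < d) (hT : 0 < T) (hd' : 0 < lastLayer d)
    (rule : SelectionRule d K) (hconf : Confident T δ D X θ) {b : Fin K}
    (hb : ∀ j, inner ℝ θ (X j) ≤ inner ℝ θ (X b)) (hl : layer T δ D X ≠ lastLayer d) :
    inner ℝ θ (X b) - inner ℝ θ (X (policy T δ D X rule)) ≤
      8 * width T δ D X (layer T δ D X) (policy T δ D X rule) ^ 2 /
        accuracy d T (layer T δ D X) := by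
  have hbm := best_mem_active hd' hconf hb _ le_rfl
  have hmem := policy_mem_active rule ⟨b, hbm⟩
  have hw := (Finset.mem_filter.mp (policy_mem_widest rule ⟨b, hbm⟩ hl)).2
  have hacc := accuracy_pos hd hT (layer T δ D X)
  have hgt : accuracy d T (layer T δ D X) <
      width T δ D X (layer T δ D X) (policy T δ D X rule) := by
    rcases stops_layer T δ D X with h | ⟨i, hi, h⟩
    · exact absurd h hl
    · exact h.trans_le (hw i hi)
  rw [le_div_iff₀ hacc]
  rcases hlay : layer T δ D X with _ | κ
  · rw [hlay] at hgt hmem hbm hacc hw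
    have h1 := abs_le.mp (hconf 0 hd' b)
    have h2 := abs_le.mp (hconf 0 hd' (policy T δ D X rule))
    have h3 := (Finset.mem_filter.mp hmem).2 b
    have h4 := hw b hbm
    -- The intervals of the two arms overlap, so the gap is at most twice the sum of their widths,
    -- and the played arm is the wider one.
    have h5 : inner ℝ θ (X b) - inner ℝ θ (X (policy T δ D X rule)) ≤
        4 * width T δ D X 0 (policy T δ D X rule) := by linarith
    nlinarith
  · have h1 := gap_le_of_mem_active hd' hconf hb (κ := κ) (by omega)
      (i := policy T δ D X rule) (by rw [← hlay]; exact hmem)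
    rw [hlay] at hgt hacc
    have h2 : accuracy d T κ = 2 * accuracy d T (κ + 1) := by
      rw [accuracy]; ring
    rw [h2] at h1
    nlinarith

lemma gap_le_of_layer_eq (hd' : 0 < lastLayer d)
    (rule : SelectionRule d K) (hconf : Confident T δ D X θ) {b : Fin K}
    (hb : ∀ j, inner ℝ θ (X j) ≤ inner ℝ θ (X b)) (hl : layer T δ D X = lastLayer d) :
    inner ℝ θ (X b) - inner ℝ θ (X (policy T δ D X rule)) ≤
      4 * accuracy d T (lastLayer d - 1) := by
  have hmem := policy_mem_active rule ⟨b, best_mem_active hd' hconf hb _ le_rfl⟩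
  refine gap_le_of_mem_active hd' hconf hb (by omega) ?_
  rwa [Nat.sub_add_cancel hd', ← hl]

end Round

/-! ### Sizes of the algorithm's parameters -/

section Parameters

variable {d K T : ℕ} {δ : ℝ}

lemma lastLayer_pos (hd : 2 ≤ d) : 0 < lastLayer d :=
  Nat.ceil_pos.mpr (Real.logb_pos (by norm_num) (by exact_mod_cast hd))

lemma accuracy_eq (κ : ℕ) : accuracy d T κ = d * √d / √T / 2 ^ κ := by
  induction κ with
  | zero =>
    rw [accuracy, pow_zero, div_one]
    congr 1
    rw [Real.sqrt_eq_rpow]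
    rcases Nat.eq_zero_or_pos d with rfl | hd
    · norm_num
    · have hd' : (0 : ℝ) < d := by exact_mod_cast hd
      conv_rhs => rw [← Real.rpow_one_add' hd'.le (by norm_num)]
      norm_num
  | succ κ ih =>
    rw [accuracy, ih, pow_succ]
    field_simp

/-- Below `κ₀ = ⌈log₂ d⌉` one has `2 ^ κ ≤ d`, so halving never goes below `√(d/T)`. -/
lemma le_accuracy (hd : 0 < d) {κ : ℕ} (hκ : κ < lastLayer d) :
    √d / √T ≤ accuracy d T κ := by
  have hd' : (0 : ℝ) < d := by exact_mod_cast hd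
  have h1 : (κ : ℝ) < Real.logb 2 d := Nat.lt_ceil.mp hκ
  have h2 : (2 : ℝ) ^ κ ≤ d := by
    have := (Real.lt_logb_iff_rpow_lt (by norm_num) hd').mp h1
    rw [Real.rpow_natCast] at this
    exact this.le
  rw [accuracy_eq, le_div_iff₀ (by positivity), mul_comm, mul_div_assoc]
  exact mul_le_mul_of_nonneg_right h2 (by positivity)

lemma accuracy_last_le (hd : 2 ≤ d) :
    accuracy d T (lastLayer d - 1) ≤ 2 * (√d / √T) := by
  have hd' : (0 : ℝ) < d := by positivity
  have h2 : (d : ℝ) ≤ 2 * 2 ^ (lastLayer d - 1) := by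
    rw [← pow_succ', Nat.sub_add_cancel (lastLayer_pos hd)]
    have := (Real.logb_le_iff_le_rpow (b := 2) (by norm_num) hd').mp
      (Nat.le_ceil (Real.logb 2 d))
    rwa [Real.rpow_natCast] at this
  rw [accuracy_eq, div_le_iff₀ (by positivity)]
  calc d * √d / √T = d * (√d / √T) := by ring
    _ ≤ 2 * 2 ^ (lastLayer d - 1) * (√d / √T) :=
      mul_le_mul_of_nonneg_right h2 (by positivity)
    _ = _ := by ring

lemma log_le_logb_two {y : ℝ} (hy : 1 ≤ y) : Real.log y ≤ Real.logb 2 y := by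
  rw [Real.logb, le_div_iff₀ (Real.log_pos (by norm_num))]
  nlinarith [Real.log_nonneg hy, Real.log_two_lt_d9]

lemma one_le_logb_two {n : ℕ} (hn : 2 ≤ n) : 1 ≤ Real.logb 2 n := by
  rw [Real.le_logb_iff_rpow_le (by norm_num) (by positivity)]
  simpa using hn

lemma four_le_ratio (hd : 2 ≤ d) (hK : 1 ≤ K) (hT : 2 ≤ T) (hδ : 0 < δ) (hδ1 : δ < 1) :
    4 ≤ d * K * T / δ := by
  have hd' : (2 : ℝ) ≤ d := by exact_mod_cast hd
  have hK' : (1 : ℝ) ≤ K := by exact_mod_cast hK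
  have hT' : (2 : ℝ) ≤ T := by exact_mod_cast hT
  rw [le_div_iff₀ hδ]
  have h1 : (2 : ℝ) ≤ d * K := by nlinarith
  nlinarith

lemma two_le_logb_ratio (hd : 2 ≤ d) (hK : 1 ≤ K) (hT : 2 ≤ T) (hδ : 0 < δ) (hδ1 : δ < 1) :
    2 ≤ Real.logb 2 (d * K * T / δ) := by
  have h := four_le_ratio hd hK hT hδ hδ1
  rw [Real.le_logb_iff_rpow_le (by norm_num) (by linarith)]
  norm_num
  exact h

/-- In layer `0` the extra factor `d` of `α_0²` is cancelled by the coarser accuracy `d √d / √T`;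
the other layers have no such factor and accuracy at least `√d / √T`. The constant is `10²` times
`2`, the latter absorbing the `2` inside the logarithm. -/
lemma alpha_sq_div_accuracy_le (hd : 2 ≤ d) (hK : 1 ≤ K) (hT : 2 ≤ T) (hδ : 0 < δ)
    (hδ1 : δ < 1) {κ : ℕ} (hκ : κ < lastLayer d) :
    alpha d K T δ κ ^ 2 / accuracy d T κ ≤
      200 * Real.logb 2 (d * K * T / δ) * (√T / √d) := by
  have hd' : (2 : ℝ) ≤ d := by exact_mod_cast hd
  have hK' : (1 : ℝ) ≤ K := by exact_mod_cast hK
  have hT' : (2 : ℝ) ≤ T := by exact_mod_cast hT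
  have hr := four_le_ratio hd hK hT hδ hδ1
  have hl := two_le_logb_ratio hd hK hT hδ hδ1
  have hsd : 0 < √(d : ℝ) := by positivity
  have hsT : 0 < √(T : ℝ) := by positivity
  rcases κ with _ | κ
  · have h1 : (1 : ℝ) ≤ 2 * T / δ := by
      rw [le_div_iff₀ hδ]; nlinarith
    have h2 : (2 : ℝ) * T / δ ≤ d * K * T / δ := by
      gcongr
      nlinarith
    have h3 : Real.log (2 * T / δ) ≤ Real.logb 2 (d * K * T / δ) :=
      (Real.log_le_log (by linarith) h2).trans (log_le_logb_two (by linarith))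
    have h4 : 0 ≤ Real.log (2 * T / δ) := Real.log_nonneg h1
    rw [alpha, mul_pow, Real.sq_sqrt (by positivity), accuracy_eq]
    have h5 : 2 ^ 2 * (d * Real.log (2 * T / δ)) / (d * √d / √T / 2 ^ 0) =
        4 * Real.log (2 * T / δ) * (√T / √d) := by
      field_simp
      ring
    rw [h5]
    refine mul_le_mul_of_nonneg_right ?_ (by positivity)
    linarith
  · have h3 : Real.log (2 * d * K * T / δ) ≤ 2 * Real.logb 2 (d * K * T / δ) := by
      have h1 : 2 * (d : ℝ) * K * T / δ = 2 * (d * K * T / δ) := by ring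
      rw [h1, Real.log_mul (by norm_num) (by linarith)]
      have h2 := log_le_logb_two (y := d * K * T / δ) (by linarith)
      linarith [Real.log_two_lt_d9]
    have h4 : 0 ≤ Real.log (2 * d * K * T / δ) := by
      refine Real.log_nonneg ?_
      have h1 : 2 * (d : ℝ) * K * T / δ = 2 * (d * K * T / δ) := by ring
      rw [h1]; linarith
    have h5 := le_accuracy (T := T) (by omega : 0 < d) hκ
    rw [alpha, mul_pow, Real.sq_sqrt h4]
    calc _ ≤ 200 * Real.logb 2 (d * K * T / δ) / (√d / √T) :=
          div_le_div₀ (by linarith) (by linarith) (by positivity) h5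
      _ = _ := by field_simp

end Parameters

/-! ### Elliptical potential and the regret on the good event -/

section Run

variable {d K : ℕ} (T : ℕ) (δ C : ℝ) (rule : SelectionRule d K) (θ : Vec d)
  (x : ℕ → Contexts d K) (ε : ℕ → ℝ)

lemma log_det_mono (κ t : ℕ) :
    Real.log (info T δ C rule θ x ε κ t).det ≤
      Real.log (info T δ C rule θ x ε κ (t + 1)).det := by
  have hP := posDef_info T δ C rule θ x ε κ t
  refine Real.log_le_log hP.det_pos ?_
  rw [info_succ]
  split_ifs
  · rw [det_add_vecMulVec hP]
    nlinarith [hP.det_pos, quad_self_nonneg hP (played T δ C rule θ x ε t).ofLp]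
  · exact le_rfl

lemma quad_info_le_log_det (t : ℕ) (hx : ∀ i, ‖x t i‖ ≤ 1) :
    quad (info T δ C rule θ x ε (layerAt T δ C rule θ x ε t) t)
        (played T δ C rule θ x ε t).ofLp (played T δ C rule θ x ε t).ofLp ≤
      2 * (Real.log (info T δ C rule θ x ε (layerAt T δ C rule θ x ε t) (t + 1)).det -
        Real.log (info T δ C rule θ x ε (layerAt T δ C rule θ x ε t) t).det) := by
  set κ := layerAt T δ C rule θ x ε t
  have hP := posDef_info T δ C rule θ x ε κ t
  set u := quad (info T δ C rule θ x ε κ t)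
        (played T δ C rule θ x ε t).ofLp (played T δ C rule θ x ε t).ofLp with hu
  have h0 : 0 ≤ u := quad_self_nonneg hP _
  have h1 : u ≤ 1 := (quad_info_le T δ C rule θ x ε κ t _).trans
    (dotProduct_self_le_one (hx _))
  rw [info_succ, if_pos rfl, det_add_vecMulVec hP, ← hu,
    Real.log_mul hP.det_pos.ne' (by linarith), add_sub_cancel_left]
  -- From `2u / (u + 2) ≤ log (1 + u)` and `u ≤ 1` one gets `u ≤ 2 log (1 + u)`.
  have h2 := Real.le_log_one_add_of_nonneg h0
  refine le_trans ?_ (mul_le_mul_of_nonneg_left h2 (by norm_num))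
  rw [← mul_div_assoc, le_div_iff₀ (by linarith)]
  nlinarith

/-- Summing over all layers, although one of them suffices, makes the bound telescope in `t` for
each `κ`. The factor `16 C` combines `8` from the gap, `C` from the frozen matrix and `2` from the
potential. -/
lemma regret_round_le (hd : 2 ≤ d) (hK : 1 ≤ K) (hT : 2 ≤ T) (hC : 1 < C) (t : ℕ)
    (hx : ∀ i, ‖x t i‖ ≤ 1)
    (hconf : Confident T δ (run T δ C rule θ x ε t).frozen (x t) θ) :
    (⨆ i : Fin K, inner ℝ θ (x t i)) - inner ℝ θ (x t (policyAt T δ C rule θ x ε t (x t))) ≤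
      4 * accuracy d T (lastLayer d - 1) + ∑ κ ∈ Finset.range (lastLayer d),
        16 * C * (alpha d K T δ κ ^ 2 / accuracy d T κ) *
          (Real.log (info T δ C rule θ x ε κ (t + 1)).det -
            Real.log (info T δ C rule θ x ε κ t).det) := by
  have : Nonempty (Fin K) := ⟨⟨0, hK⟩⟩
  obtain ⟨b, hb⟩ := Finite.exists_max fun i : Fin K => (inner ℝ θ (x t i) : ℝ)
  have hsup : (⨆ i : Fin K, inner ℝ θ (x t i)) ≤ inner ℝ θ (x t b) := ciSup_le hb
  refine (sub_le_sub_right hsup _).trans ?_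
  have hd' := lastLayer_pos hd
  have hacc : ∀ κ, 0 < accuracy d T κ := accuracy_pos (by omega) (by omega)
  have hterm : ∀ κ, 0 ≤ 16 * C * (alpha d K T δ κ ^ 2 / accuracy d T κ) *
      (Real.log (info T δ C rule θ x ε κ (t + 1)).det -
            Real.log (info T δ C rule θ x ε κ t).det) := fun κ =>
    mul_nonneg (mul_nonneg (by linarith) (div_nonneg (sq_nonneg _) (hacc κ).le))
      (sub_nonneg.mpr (log_det_mono T δ C rule θ x ε κ t))
  by_cases hl : layerAt T δ C rule θ x ε t = lastLayer d
  · have h1 := gap_le_of_layer_eq hd' rule hconf hb hl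
    have h2 := Finset.sum_nonneg fun κ (_ : κ ∈ Finset.range (lastLayer d)) => hterm κ
    unfold policyAt
    linarith
  · have h1 := gap_le_of_layer_ne (by omega) (by omega) hd' rule hconf hb hl
    have hlt : layerAt T δ C rule θ x ε t < lastLayer d :=
      lt_of_le_of_ne (layer_le_lastLayer T δ _ _) hl
    have h2 := Finset.single_le_sum (fun κ _ => hterm κ) (Finset.mem_range.mpr hlt)
    have h3 := quad_info_le_log_det T δ C rule θ x ε t hx
    have h4 := quad_frozen_le T δ C rule θ x ε hC (layerAt T δ C rule θ x ε t) t
      (played T δ C rule θ x ε t).ofLp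
    refine le_trans ?_ (le_add_of_nonneg_left (by linarith [hacc (lastLayer d - 1)]))
    refine le_trans ?_ h2
    unfold policyAt
    refine h1.trans ?_
    rw [width_eq, mul_pow, Real.sq_sqrt (quad_self_nonneg (posDef_frozen T δ C rule θ x ε _ t) _)]
    change 8 * (alpha d K T δ (layerAt T δ C rule θ x ε t) ^ 2 *
      quad ((run T δ C rule θ x ε t).frozen (layerAt T δ C rule θ x ε t)).1
        (played T δ C rule θ x ε t).ofLp (played T δ C rule θ x ε t).ofLp) /
        accuracy d T (layerAt T δ C rule θ x ε t) ≤ _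
    have h5 := h4.trans (mul_le_mul_of_nonneg_left h3 (by linarith))
    have h6 : 0 ≤ 8 * (alpha d K T δ (layerAt T δ C rule θ x ε t) ^ 2 /
        accuracy d T (layerAt T δ C rule θ x ε t)) :=
      mul_nonneg (by norm_num) (div_nonneg (sq_nonneg _) (hacc _).le)
    have h7 := mul_le_mul_of_nonneg_left h5 h6
    refine le_trans (le_of_eq ?_) (h7.trans (le_of_eq ?_)) <;> ring

/-- The potentials telescope to `log det ≤ d log T` in each of at most `2 log d` layers, giving `2 ·
16 · 200 = 6400`; the last layer adds `T · 8 √(d/T) = 8 √(dT)`. -/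
theorem regret_le_of_confident (hd : 2 ≤ d) (hK : 1 ≤ K) (hT : 2 ≤ T) (hδ : 0 < δ)
    (hδ1 : δ < 1) (hC : 2 ≤ C) (hx : ∀ t < T, ∀ i, ‖x t i‖ ≤ 1)
    (hconf : ∀ t < T, Confident T δ (run T δ C rule θ x ε t).frozen (x t) θ) :
    regret T δ C rule θ x ε ≤
      6408 * (C * √(d * T) * Real.logb 2 d * Real.logb 2 T *
              Real.logb 2 (d * K * T / δ)) := by
  have hsd : 0 < √(d : ℝ) := by positivity
  have hsT : 0 < √(T : ℝ) := by positivity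
  have h1 : regret T δ C rule θ x ε ≤ ∑ t ∈ Finset.range T,
      (4 * accuracy d T (lastLayer d - 1) + ∑ κ ∈ Finset.range (lastLayer d),
        16 * C * (alpha d K T δ κ ^ 2 / accuracy d T κ) *
          (Real.log (info T δ C rule θ x ε κ (t + 1)).det -
            Real.log (info T δ C rule θ x ε κ t).det)) :=
    Finset.sum_le_sum fun t ht => by
      rw [Finset.mem_range] at ht
      exact regret_round_le T δ C rule θ x ε hd hK hT (by linarith) t (hx t ht) (hconf t ht)
  rw [Finset.sum_add_distrib, Finset.sum_const, Finset.card_range, nsmul_eq_mul,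
    Finset.sum_comm] at h1
  have hlT := one_le_logb_two hT
  have hld := one_le_logb_two hd
  have hl := two_le_logb_ratio hd hK hT hδ hδ1
  set l := Real.logb 2 (d * K * T / δ)
  have h2 : ∑ κ ∈ Finset.range (lastLayer d), ∑ t ∈ Finset.range T,
      16 * C * (alpha d K T δ κ ^ 2 / accuracy d T κ) *
          (Real.log (info T δ C rule θ x ε κ (t + 1)).det -
            Real.log (info T δ C rule θ x ε κ t).det) ≤
      ∑ κ ∈ Finset.range (lastLayer d),
        16 * C * (200 * l * (√T / √d)) * (d * Real.logb 2 T) := by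
    refine Finset.sum_le_sum fun κ hκ => ?_
    rw [Finset.mem_range] at hκ
    rw [← Finset.mul_sum, Finset.sum_range_sub (fun t =>
      Real.log (info T δ C rule θ x ε κ t).det), info_zero, Matrix.det_one, Real.log_one,
      sub_zero]
    have h3 := alpha_sq_div_accuracy_le hd hK hT hδ hδ1 hκ
    have h4 : Real.log (info T δ C rule θ x ε κ T).det ≤ d * Real.logb 2 T := by
      refine (Real.log_le_log (posDef_info T δ C rule θ x ε κ T).det_pos
        (det_info_le T δ C rule θ x ε hd hT hx κ T le_rfl)).trans ?_
      rw [Real.log_pow]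
      exact mul_le_mul_of_nonneg_left (log_le_logb_two (by norm_cast; omega)) (by positivity)
    have h5 : 0 ≤ Real.log (info T δ C rule θ x ε κ T).det :=
      Real.log_nonneg (one_le_det_info T δ C rule θ x ε κ T)
    exact mul_le_mul (mul_le_mul_of_nonneg_left h3 (by linarith)) h4 h5 (by positivity)
  rw [Finset.sum_const, Finset.card_range, nsmul_eq_mul] at h2
  have h3 : (lastLayer d : ℝ) * (16 * C * (200 * l * (√T / √d)) * (d * Real.logb 2 T)) ≤
      2 * Real.logb 2 d * (16 * C * (200 * l * (√T / √d)) * (d * Real.logb 2 T)) :=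
    mul_le_mul_of_nonneg_right (lastLayer_le hd) (by positivity)
  have h4 : 2 * Real.logb 2 d * (16 * C * (200 * l * (√T / √d)) * (d * Real.logb 2 T)) =
      6400 * (C * √(d * T) * Real.logb 2 d * Real.logb 2 T * l) := by
    rw [Real.sqrt_mul (by positivity)]
    have : (d : ℝ) * (√T / √d) = √d * √T := by
      rw [← mul_div_assoc, div_eq_iff hsd.ne']
      nlinarith [Real.mul_self_sqrt (show (0 : ℝ) ≤ d by positivity)]
    linear_combination (6400 * C * Real.logb 2 d * Real.logb 2 T * l) * this
  have h5 : (T : ℝ) * (4 * accuracy d T (lastLayer d - 1)) ≤ 8 * √(d * T) := by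
    have h6 := mul_le_mul_of_nonneg_left (accuracy_last_le (T := T) hd)
      (show (0 : ℝ) ≤ T * 4 by positivity)
    have h7 : (T : ℝ) * 4 * (2 * (√d / √T)) = 8 * √(d * T) := by
      rw [Real.sqrt_mul (by positivity)]
      have : (T : ℝ) * (√d / √T) = √d * √T := by
        rw [← mul_div_assoc, div_eq_iff hsT.ne']
        nlinarith [Real.mul_self_sqrt (show (0 : ℝ) ≤ T by positivity)]
      linear_combination 8 * this
    linarith
  have h6 : √(d * T) ≤ C * √(d * T) * Real.logb 2 d * Real.logb 2 T * l := by
    have e1 : 1 ≤ C * Real.logb 2 d := by nlinarith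
    have e2 : 1 ≤ C * Real.logb 2 d * Real.logb 2 T := by nlinarith
    have e3 : 1 ≤ C * Real.logb 2 d * Real.logb 2 T * l := by nlinarith
    nlinarith [Real.sqrt_nonneg ((d : ℝ) * T)]
  linarith

lemma regret_le_two_mul (hK : 1 ≤ K) (hθ : ‖θ‖ ≤ 1) (hx : ∀ t < T, ∀ i, ‖x t i‖ ≤ 1) :
    regret T δ C rule θ x ε ≤ 2 * T := by
  have : Nonempty (Fin K) := ⟨⟨0, hK⟩⟩
  have hin : ∀ t < T, ∀ i, |(inner ℝ θ (x t i) : ℝ)| ≤ 1 := fun t ht i =>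
    (abs_real_inner_le_norm _ _).trans (mul_le_one₀ hθ (norm_nonneg _) (hx t ht i))
  have h : regret T δ C rule θ x ε ≤ ∑ _t ∈ Finset.range T, (2 : ℝ) := by
    refine Finset.sum_le_sum fun t ht => ?_
    rw [Finset.mem_range] at ht
    have h1 : (⨆ i : Fin K, inner ℝ θ (x t i)) ≤ 1 :=
      ciSup_le fun i => (abs_le.mp (hin t ht i)).2
    linarith [(abs_le.mp (hin t ht (policyAt T δ C rule θ x ε t (x t)))).1]
  simpa [mul_comm] using h

end Run

/-! ### Measurability of the run in contexts and noise -/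

section Measurability

instance (d : ℕ) : MeasurableSpace (Matrix (Fin d) (Fin d) ℝ) :=
  inferInstanceAs (MeasurableSpace (Fin d → Fin d → ℝ))

instance (d : ℕ) : BorelSpace (Matrix (Fin d) (Fin d) ℝ) :=
  inferInstanceAs (BorelSpace (Fin d → Fin d → ℝ))

variable {α : Type*} [MeasurableSpace α] {d K : ℕ}

lemma measurable_matrix_iff {M : α → Matrix (Fin d) (Fin d) ℝ} :
    Measurable M ↔ ∀ i j, Measurable fun a => M a i j :=
  (measurable_pi_iff (X := fun _ : Fin d => Fin d → ℝ)).trans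
    (forall_congr' fun _ => measurable_pi_iff)

lemma measurable_matrix_det {M : α → Matrix (Fin d) (Fin d) ℝ} (hM : Measurable M) :
    Measurable fun a => (M a).det :=
  (continuous_id.matrix_det : Continuous fun A : Matrix (Fin d) (Fin d) ℝ => A.det).measurable.comp
    hM

lemma measurable_matrix_inv {M : α → Matrix (Fin d) (Fin d) ℝ} (hM : Measurable M) :
    Measurable fun a => (M a)⁻¹ := by
  have h1 : Measurable fun a => (M a).adjugate :=
    (continuous_id.matrix_adjugate :
      Continuous fun A : Matrix (Fin d) (Fin d) ℝ => A.adjugate).measurable.comp hM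
  rw [measurable_matrix_iff] at h1 ⊢
  intro i j
  simp only [Matrix.inv_def, Ring.inverse_eq_inv', Matrix.smul_apply, smul_eq_mul]
  exact (measurable_matrix_det hM).inv.mul (h1 i j)

lemma measurable_quad {M : α → Matrix (Fin d) (Fin d) ℝ} {u v : α → Fin d → ℝ}
    (hM : Measurable M) (hu : Measurable u) (hv : Measurable v) :
    Measurable fun a => quad (M a) (u a) (v a) := by
  have h1 := measurable_matrix_iff.mp (measurable_matrix_inv hM)
  have hu' := measurable_pi_iff.mp hu
  have hv' := measurable_pi_iff.mp hv
  simp only [quad, dotProduct, Matrix.mulVec]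
  exact Finset.measurable_fun_sum _ fun i _ => (hu' i).mul
    (Finset.measurable_fun_sum _ fun j _ => (h1 i j).mul (hv' j))

lemma measurable_ofLp_vec {v : α → Vec d} (hv : Measurable v) :
    Measurable fun a => (v a).ofLp :=
  (PiLp.continuous_ofLp 2 (fun _ : Fin d => ℝ)).measurable.comp hv

lemma measurable_prop_le {f g : α → ℝ} (hf : Measurable f) (hg : Measurable g) :
    Measurable fun a => f a ≤ g a :=
  measurableSet_setOfPred.mp (measurableSet_le hf hg)

lemma measurable_prop_lt {f g : α → ℝ} (hf : Measurable f) (hg : Measurable g) :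
    Measurable fun a => f a < g a :=
  measurableSet_setOfPred.mp (measurableSet_lt hf hg)

variable (T : ℕ) (δ : ℝ) {D : α → Stats d} {X : α → Contexts d K}

lemma measurable_rhat (hD : Measurable D) (hX : Measurable X) (κ : ℕ) (i : Fin K) :
    Measurable fun a => rhat (D a) (X a) κ i :=
  measurable_quad (measurable_fst.comp (measurable_pi_iff.mp hD κ))
    (measurable_ofLp_vec (measurable_pi_iff.mp hX i))
    (measurable_snd.comp (measurable_pi_iff.mp hD κ))

lemma measurable_width (hD : Measurable D) (hX : Measurable X) (κ : ℕ) (i : Fin K) :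
    Measurable fun a => width T δ (D a) (X a) κ i :=
  (measurable_quad (measurable_fst.comp (measurable_pi_iff.mp hD κ))
    (measurable_ofLp_vec (measurable_pi_iff.mp hX i))
    (measurable_ofLp_vec (measurable_pi_iff.mp hX i))).sqrt.const_mul _

lemma measurable_mem_active (hD : Measurable D) (hX : Measurable X) (κ : ℕ) (i : Fin K) :
    Measurable fun a => i ∈ active T δ (D a) (X a) κ := by
  have hr := measurable_rhat hD hX
  have hw := measurable_width T δ hD hX
  induction κ generalizing i with
  | zero =>
    simp only [active, Finset.mem_filter, Finset.mem_univ, true_and]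
    exact Measurable.forall fun j =>
      measurable_prop_le ((hr 0 j).sub (hw 0 j)) ((hr 0 i).add (hw 0 i))
  | succ κ ih =>
    simp only [active, Finset.mem_filter]
    exact (ih i).and (Measurable.forall fun j => (ih j).imp
      (measurable_prop_le ((hr κ j).sub_const _) (hr κ i)))

lemma measurable_finset_eq {F : α → Finset (Fin K)} (hF : ∀ i, Measurable fun a => i ∈ F a)
    (A : Finset (Fin K)) : Measurable fun a => F a = A := by
  simp only [Finset.ext_iff]
  exact Measurable.forall fun i => (hF i).iff measurable_const

lemma measurable_mem_widest (hD : Measurable D) (hX : Measurable X) (κ : ℕ) (i : Fin K) :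
    Measurable fun a => i ∈ widest T δ (D a) (X a) κ := by
  have hw := measurable_width T δ hD hX
  have ha := measurable_mem_active T δ hD hX
  simp only [widest, Finset.mem_filter]
  exact (ha κ i).and (Measurable.forall fun j => (ha κ j).imp
      (measurable_prop_le (hw κ j) (hw κ i)))

lemma measurable_stops (hD : Measurable D) (hX : Measurable X) (κ : ℕ) :
    Measurable fun a => Stops T δ (D a) (X a) κ :=
  measurable_const.or (Measurable.exists fun i => (measurable_mem_active T δ hD hX κ i).and
    (measurable_prop_lt measurable_const (measurable_width T δ hD hX κ i)))

lemma measurable_layer_eq (hD : Measurable D) (hX : Measurable X) (κ : ℕ) :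
    Measurable fun a => layer T δ (D a) (X a) = κ := by
  simp only [layer_eq_iff]
  exact (measurable_stops T δ hD hX κ).and (Measurable.forall fun j =>
    measurable_const.imp (measurable_stops T δ hD hX j).not)

lemma measurable_policy (rule : SelectionRule d K) (hD : Measurable D) (hX : Measurable X) :
    Measurable fun a => policy T δ (D a) (X a) rule := by
  have h : ∀ i, Measurable fun a => policy T δ (D a) (X a) rule = i := by
    intro i
    -- Splitting by the values of the layer and of the surviving or widest set, which are countably
    -- many, leaves the selection rule to be evaluated at a fixed set.
    have heq : ∀ a, (policy T δ (D a) (X a) rule = i) ↔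
        (layer T δ (D a) (X a) = lastLayer d ∧
          ∃ A, active T δ (D a) (X a) (lastLayer d) = A ∧ rule.last (D a) (X a) A = i) ∨
        (¬ layer T δ (D a) (X a) = lastLayer d ∧ ∃ κ, layer T δ (D a) (X a) = κ ∧
          ∃ A, widest T δ (D a) (X a) κ = A ∧ rule.tie A = i) := by
      intro a
      unfold policy
      split_ifs with hl <;> simp [hl]
    simp only [heq]
    have hlast : ∀ A, Measurable fun a => rule.last (D a) (X a) A := fun A =>
      (rule.last_measurable A).comp (hD.prodMk hX)
    refine ((measurable_layer_eq T δ hD hX _).and (Measurable.exists fun A =>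
      (measurable_finset_eq (measurable_mem_active T δ hD hX _) A).and ?_)).or
      ((measurable_layer_eq T δ hD hX _).not.and (Measurable.exists fun κ =>
        (measurable_layer_eq T δ hD hX κ).and (Measurable.exists fun A =>
          (measurable_finset_eq (measurable_mem_widest T δ hD hX κ) A).and measurable_const)))
    exact measurableSet_setOfPred.mp (hlast A (measurableSet_singleton i))
  exact measurable_to_countable' fun i => measurableSet_setOfPred.mpr (h i)

variable (C : ℝ) (rule : SelectionRule d K) (θ : Vec d) {x : ℕ → α → Contexts d K}
  {ε : ℕ → α → ℝ}

lemma measurable_played_of_frozen (hx : ∀ t, Measurable (x t)) (t : ℕ)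
    (hf : Measurable fun a => (run T δ C rule θ (fun t => x t a) (fun t => ε t a) t).frozen) :
    Measurable fun a => played T δ C rule θ (fun t => x t a) (fun t => ε t a) t := by
  have hp := measurable_policy T δ rule hf (hx t)
  -- The arm index is itself random, so the vector is written as a finite sum over its possible
  -- values.
  have heq : ∀ a, played T δ C rule θ (fun t => x t a) (fun t => ε t a) t =
      ∑ i, if policy T δ (run T δ C rule θ (fun t => x t a) (fun t => ε t a) t).frozen (x t a)
        rule = i then x t a i else 0 := by
    intro a
    simp [played, policyAt]
  simp only [heq]
  exact Finset.measurable_fun_sum _ fun i _ => Measurable.ite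
    (hp (measurableSet_singleton i)) (measurable_pi_iff.mp (hx t) i) measurable_const

lemma measurable_run (hx : ∀ t, Measurable (x t)) (hε : ∀ t, Measurable (ε t)) (t : ℕ) :
    (Measurable fun a => (run T δ C rule θ (fun t => x t a) (fun t => ε t a) t).cur) ∧
      Measurable fun a => (run T δ C rule θ (fun t => x t a) (fun t => ε t a) t).frozen := by
  induction t with
  | zero => exact ⟨measurable_const, measurable_const⟩
  | succ t ih =>
    obtain ⟨hc, hf⟩ := ih
    have hlay := measurable_layer_eq T δ hf (hx t)
    have hpl := measurable_played_of_frozen T δ C rule θ hx t hf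
    have hplv := measurable_ofLp_vec hpl
    have hc' : Measurable fun a =>
        (run T δ C rule θ (fun t => x t a) (fun t => ε t a) (t + 1)).cur := by
      refine measurable_pi_iff.mpr fun κ => ?_
      have hcκ := measurable_pi_iff.mp hc κ
      simp only [cur_succ]
      refine Measurable.ite (measurableSet_setOfPred.mpr (hlay κ)) (Measurable.prodMk ?_ ?_) hcκ
      · refine measurable_matrix_iff.mpr fun i j => ?_
        simp only [Matrix.add_apply, Matrix.vecMulVec_apply]
        exact (measurable_matrix_iff.mp (measurable_fst.comp hcκ) i j).add
          ((measurable_pi_iff.mp hplv i).mul (measurable_pi_iff.mp hplv j))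
      · exact (measurable_snd.comp hcκ).add
          (((measurable_const.inner hpl).add (hε t)).smul hplv)
    refine ⟨hc', measurable_pi_iff.mpr fun κ => ?_⟩
    simp only [frozen_succ]
    have hcκ := measurable_pi_iff.mp hc' κ
    have hfκ := measurable_pi_iff.mp hf κ
    exact Measurable.ite (measurableSet_le
      ((measurable_matrix_det (measurable_fst.comp hfκ)).const_mul C)
      (measurable_matrix_det (measurable_fst.comp hcκ))) hcκ hfκ

lemma measurable_info (hx : ∀ t, Measurable (x t)) (hε : ∀ t, Measurable (ε t)) (κ t : ℕ) :
    Measurable fun a => info T δ C rule θ (fun t => x t a) (fun t => ε t a) κ t :=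
  measurable_fst.comp
    (measurable_pi_iff.mp (measurable_run T δ C rule θ hx hε t).1 κ)

lemma measurable_layerAt_eq (hx : ∀ t, Measurable (x t)) (hε : ∀ t, Measurable (ε t))
    (κ t : ℕ) :
    Measurable fun a => layerAt T δ C rule θ (fun t => x t a) (fun t => ε t a) t = κ :=
  measurable_layer_eq T δ (measurable_run T δ C rule θ hx hε t).2 (hx t) κ

lemma measurable_played (hx : ∀ t, Measurable (x t)) (hε : ∀ t, Measurable (ε t)) (t : ℕ) :
    Measurable fun a => (played T δ C rule θ (fun t => x t a) (fun t => ε t a) t).ofLp :=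
  measurable_ofLp_vec
    (measurable_played_of_frozen T δ C rule θ hx t (measurable_run T δ C rule θ hx hε t).2)

lemma measurable_noiseSum (hx : ∀ t, Measurable (x t)) (hε : ∀ t, Measurable (ε t))
    (κ t : ℕ) :
    Measurable fun a => noiseSum T δ C rule θ (fun t => x t a) (fun t => ε t a) κ t :=
  Finset.measurable_fun_sum _ fun s _ => Measurable.ite
    (measurableSet_setOfPred.mpr (measurable_layerAt_eq T δ C rule θ hx hε κ s))
    ((hε s).smul (measurable_played T δ C rule θ hx hε s)) measurable_const

end Measurability

section Invariance

/-! ### The noise of a layer does not influence its information matrix -/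

variable {d K T : ℕ} {δ : ℝ} {D D' : Stats d} {X : Contexts d K}

/-- The statistics agree in the layers below `κ`, and the information matrices in layer `κ`. -/
def AgreeUpTo (κ : ℕ) (D D' : Stats d) : Prop :=
  (∀ j < κ, D j = D' j) ∧ (D κ).1 = (D' κ).1

lemma AgreeUpTo.fst_eq {κ : ℕ} (h : AgreeUpTo κ D D') {j : ℕ} (hj : j ≤ κ) :
    (D j).1 = (D' j).1 := by
  rcases hj.lt_or_eq with hlt | rfl
  · rw [h.1 j hlt]
  · exact h.2

lemma AgreeUpTo.width_eq {κ : ℕ} (h : AgreeUpTo κ D D') {j : ℕ} (hj : j ≤ κ) :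
    width T δ D X j = width T δ D' X j := by
  funext i
  simp only [SupLin.width_eq, h.fst_eq hj]

/-- For `j > 0` the set `A^(j)` uses estimates of layers below `j` only, but `A^(0)` already uses
those of layer `0`. Hence `0 < κ`, and layer `0` needs a different concentration bound. -/
lemma AgreeUpTo.active_eq {κ : ℕ} (h : AgreeUpTo κ D D') (hκ : 0 < κ) {j : ℕ} (hj : j ≤ κ) :
    active T δ D X j = active T δ D' X j := by
  have hr : ∀ j < κ, rhat D X j = rhat D' X j := fun j hj => by
    funext i
    simp only [rhat, h.1 j hj]
  induction j with
  | zero => simp only [active, hr 0 hκ, h.width_eq (Nat.zero_le κ)]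
  | succ j ih => simp only [active, ih (by omega), hr j (by omega)]

lemma AgreeUpTo.stops_iff {κ : ℕ} (h : AgreeUpTo κ D D') (hκ : 0 < κ) {j : ℕ} (hj : j ≤ κ) :
    Stops T δ D X j ↔ Stops T δ D' X j := by
  simp only [Stops, h.active_eq hκ hj, h.width_eq hj]

lemma AgreeUpTo.layer_eq_iff {κ : ℕ} (h : AgreeUpTo κ D D') (hκ : 0 < κ) {j : ℕ}
    (hj : j ≤ κ) : layer T δ D X = j ↔ layer T δ D' X = j := by
  rw [SupLin.layer_eq_iff, SupLin.layer_eq_iff, h.stops_iff hκ hj]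
  refine and_congr_right fun _ => forall₂_congr fun i hi => ?_
  rw [h.stops_iff hκ (by omega)]

/-- Below the last layer the arm is chosen by widths alone; the choice in the last layer may inspect
all statistics, which explains `κ < lastLayer d`. -/
lemma AgreeUpTo.policy_eq {κ : ℕ} (h : AgreeUpTo κ D D') (hκ : 0 < κ) (hκ' : κ < lastLayer d)
    (rule : SelectionRule d K) (hl : layer T δ D X ≤ κ) :
    policy T δ D X rule = policy T δ D' X rule := by
  have hl' : layer T δ D' X = layer T δ D X := (h.layer_eq_iff hκ hl).mp rfl
  unfold policy
  rw [hl', if_neg (by omega), if_neg (by omega)]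
  simp only [widest, h.active_eq hκ hl, h.width_eq hl]

variable (T δ) (C : ℝ) (rule : SelectionRule d K) (θ : Vec d)
  (x : ℕ → Contexts d K) (ε ε' : ℕ → ℝ)

lemma run_congr {n : ℕ} {x' : ℕ → Contexts d K} (hx : ∀ t < n, x t = x' t)
    (h : ∀ t < n, ε t = ε' t) :
    run T δ C rule θ x ε n = run T δ C rule θ x' ε' n := by
  induction n with
  | zero => rfl
  | succ n ih =>
    simp only [run, ih (fun t ht => hx t (by omega)) (fun t ht => h t (by omega)),
      h n (by omega), hx n (by omega)]

/-- The altered reward enters only the reward sum of layer `κ`. Layers above `κ` may then diverge,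
but rounds ending in a layer `≤ κ` never consult them, and freezing looks at determinants only. -/
lemma agreeUpTo_run {κ k : ℕ} (hκ : 0 < κ) (hκ' : κ < lastLayer d)
    (hk : layerAt T δ C rule θ x ε k = κ) (h : ∀ t, t ≠ k → ε t = ε' t) (t : ℕ) :
    AgreeUpTo κ (run T δ C rule θ x ε t).cur (run T δ C rule θ x ε' t).cur ∧
      AgreeUpTo κ (run T δ C rule θ x ε t).frozen (run T δ C rule θ x ε' t).frozen := by
  induction t with
  | zero => exact ⟨⟨fun _ _ => rfl, rfl⟩, ⟨fun _ _ => rfl, rfl⟩⟩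
  | succ t ih =>
    obtain ⟨hc, hf⟩ := ih
    have hlay : ∀ j ≤ κ, (layerAt T δ C rule θ x ε t = j ↔ layerAt T δ C rule θ x ε' t = j) :=
      fun j hj => hf.layer_eq_iff hκ hj
    have hpl : layerAt T δ C rule θ x ε t ≤ κ →
        played T δ C rule θ x ε t = played T δ C rule θ x ε' t := fun hl => by
      unfold played policyAt
      rw [hf.policy_eq hκ hκ' rule hl]
    have hinfo : ∀ j ≤ κ, info T δ C rule θ x ε j (t + 1) = info T δ C rule θ x ε' j (t + 1) := by
      intro j hj
      rw [info_succ, info_succ]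
      have h0 : info T δ C rule θ x ε j t = info T δ C rule θ x ε' j t := hc.fst_eq hj
      by_cases hl : layerAt T δ C rule θ x ε t = j
      · rw [if_pos hl, if_pos ((hlay j hj).mp hl), hpl (by omega), h0]
      · rw [if_neg hl, if_neg (fun h' => hl ((hlay j hj).mpr h')), h0]
    have hc' : AgreeUpTo κ (run T δ C rule θ x ε (t + 1)).cur
        (run T δ C rule θ x ε' (t + 1)).cur := by
      refine ⟨fun j hj => ?_, hinfo κ le_rfl⟩
      rw [cur_succ, cur_succ]
      have h0 : info T δ C rule θ x ε j t = info T δ C rule θ x ε' j t := hc.fst_eq hj.le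
      by_cases hl : layerAt T δ C rule θ x ε t = j
      -- Round `k` belongs to layer `κ > j`, so the rewards of layer `j` carry unaltered noise.
      · have htk : t ≠ k := by
          rintro rfl
          omega
        rw [if_pos hl, if_pos ((hlay j hj.le).mp hl), hpl (by omega), h0, hc.1 j hj, h t htk]
      · rw [if_neg hl, if_neg (fun h' => hl ((hlay j hj.le).mpr h')), hc.1 j hj]
    refine ⟨hc', fun j hj => ?_, ?_⟩
    · rw [frozen_succ, frozen_succ, hinfo j hj.le, hf.1 j hj, hc'.1 j hj]
    · rw [frozen_succ, frozen_succ, hinfo κ le_rfl, hf.2]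
      split_ifs
      · exact hc'.2
      · exact hf.2

/-- The coefficient of the noise of round `s` in the estimation error, in layer `κ` after `n`
rounds, of the vector `u`. -/
def noiseCoeff (κ n : ℕ) (u : Fin d → ℝ) (s : ℕ) : ℝ :=
  if s < n ∧ layerAt T δ C rule θ x ε s = κ then
    quad (info T δ C rule θ x ε κ n) u (played T δ C rule θ x ε s).ofLp else 0

lemma noiseCoeff_congr {κ k : ℕ} (hκ : 0 < κ) (hκ' : κ < lastLayer d)
    (hk : layerAt T δ C rule θ x ε k = κ) (h : ∀ t, t ≠ k → ε t = ε' t) (n : ℕ)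
    (u : Fin d → ℝ) :
    noiseCoeff T δ C rule θ x ε κ n u = noiseCoeff T δ C rule θ x ε' κ n u ∧
      info T δ C rule θ x ε κ n = info T δ C rule θ x ε' κ n := by
  have hagree := agreeUpTo_run T δ C rule θ x ε ε' hκ hκ' hk h
  have hinfo : info T δ C rule θ x ε κ n = info T δ C rule θ x ε' κ n :=
    (hagree n).1.fst_eq le_rfl
  refine ⟨?_, hinfo⟩
  funext s
  unfold noiseCoeff
  have hlay : layerAt T δ C rule θ x ε s = κ ↔ layerAt T δ C rule θ x ε' s = κ :=
    (hagree s).2.layer_eq_iff hκ le_rfl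
  simp only [hlay, hinfo]
  split_ifs with hs
  · have : played T δ C rule θ x ε s = played T δ C rule θ x ε' s := by
      unfold played policyAt
      rw [(hagree s).2.policy_eq hκ hκ' rule (hlay.mpr hs.2).le]
    rw [this]
  · rfl

/-- The sum runs to `T` rather than `n`, the coefficients being zero from `n` on, to match a product
measure over `Fin T`. -/
lemma quad_noiseSum_eq {κ n : ℕ} (hn : n ≤ T) (u : Fin d → ℝ) :
    quad (info T δ C rule θ x ε κ n) u (noiseSum T δ C rule θ x ε κ n) =
      ∑ s ∈ Finset.range T, noiseCoeff T δ C rule θ x ε κ n u s * ε s := by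
  have h1 : Finset.range n ⊆ Finset.range T := by simpa using hn
  rw [← Finset.sum_subset h1]
  · rw [noiseSum, quad_sum_right]
    refine Finset.sum_congr rfl fun s hs => ?_
    have hs' : s < n := Finset.mem_range.mp hs
    unfold noiseCoeff
    by_cases hl : layerAt T δ C rule θ x ε s = κ
    · rw [if_pos hl, if_pos ⟨hs', hl⟩, quad_smul_right, mul_comm]
    · rw [if_neg hl, if_neg (fun h => hl h.2), zero_mul]
      simp [quad]
  · intro s _ hs
    unfold noiseCoeff
    rw [if_neg (fun h => hs (Finset.mem_range.mpr h.1)), zero_mul]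

lemma sum_noiseCoeff_sq_le {κ n : ℕ} (hn : n ≤ T) (u : Fin d → ℝ) :
    ∑ s ∈ Finset.range T, noiseCoeff T δ C rule θ x ε κ n u s ^ 2 ≤
      quad (info T δ C rule θ x ε κ n) u u := by
  have h1 : Finset.range n ⊆ Finset.range T := by simpa using hn
  refine le_trans (le_of_eq ?_) (sum_quad_sq_le T δ C rule θ x ε κ n u)
  rw [← Finset.sum_subset h1]
  · refine Finset.sum_congr rfl fun s hs => ?_
    have hs' : s < n := Finset.mem_range.mp hs
    simp [noiseCoeff, hs']
  · intro s _ hs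
    unfold noiseCoeff
    rw [if_neg (fun h => hs (Finset.mem_range.mpr h.1))]
    simp

end Invariance

section SubGaussian

/-! ### Exponential moments of adapted sums of sub-Gaussian noises -/

lemma lintegral_exp_le_one {μ : Measure ℝ} (hμ : HasSubgaussianMGF id 1 μ) (g : ℝ) :
    ∫⁻ v, ENNReal.ofReal (Real.exp (g * v - g ^ 2 / 2)) ∂μ ≤ 1 := by
  have h1 : Integrable (fun v => Real.exp (g * v)) μ := hμ.integrable_exp_mul g
  have h2 : ∀ v : ℝ, Real.exp (g * v - g ^ 2 / 2) =
      Real.exp (g * v) * Real.exp (-(g ^ 2 / 2)) := fun v => by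
    rw [← Real.exp_add, sub_eq_add_neg]
  simp only [h2]
  rw [← ofReal_integral_eq_lintegral_ofReal (h1.mul_const _)
    (Filter.Eventually.of_forall fun v => by positivity), integral_mul_const,
    ← ENNReal.ofReal_one]
  refine ENNReal.ofReal_le_ofReal ?_
  have h3 : ∫ v, Real.exp (g * v) ∂μ ≤ Real.exp (g ^ 2 / 2) := by
    simpa [mgf] using hμ.mgf_le g
  calc _ ≤ Real.exp (g ^ 2 / 2) * Real.exp (-(g ^ 2 / 2)) :=
        mul_le_mul_of_nonneg_right h3 (Real.exp_nonneg _)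
    _ = 1 := by rw [← Real.exp_add]; simp

lemma lintegral_gaussian {b : ℝ} (hb : 0 < b) (h : ℝ) :
    ∫⁻ g : ℝ, ENNReal.ofReal (Real.exp (-b * (g - h) ^ 2)) =
      ENNReal.ofReal √(Real.pi / b) := by
  rw [lintegral_sub_right_eq_self (fun g => ENNReal.ofReal (Real.exp (-b * g ^ 2))) h,
    ← ofReal_integral_eq_lintegral_ofReal (integrable_exp_neg_mul_sq hb)
    (Filter.Eventually.of_forall fun v => (Real.exp_nonneg _)), integral_gaussian]

/-- The one-dimensional case of the method of mixtures. -/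
lemma lintegral_exp_mixture_le {μ : Measure ℝ} [IsProbabilityMeasure μ]
    (hμ : HasSubgaussianMGF id 1 μ) {a : ℝ} (ha : 0 ≤ a) (m : ℝ) :
    ∫⁻ v, ENNReal.ofReal
        (Real.exp ((2 * v * m + v ^ 2 * a - m ^ 2) / (2 * (1 + a)))) ∂μ ≤
      ENNReal.ofReal √(1 + a) := by
  -- For `a = 0` the mixing Gaussian degenerates to a point mass at `m`.
  rcases ha.eq_or_lt with rfl | ha
  · refine le_trans (le_of_eq ?_) ((lintegral_exp_le_one hμ m).trans (by simp))
    refine lintegral_congr fun v => ?_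
    congr 2
    ring
  set b : ℝ := (1 + a) / (2 * a) with hb
  have hb0 : 0 < b := by positivity
  -- Completing the square in `g`: the mixture is over an unnormalized Gaussian with mean `m` and
  -- variance `a`. Integrating `g` first gives the exponent sought, integrating `v` first gives at
  -- most the mass of the Gaussian.
  have hpt : ∀ v g : ℝ, Real.exp (g * v - g ^ 2 / 2) * Real.exp (-(1 / (2 * a)) * (g - m) ^ 2) =
      Real.exp ((2 * v * m + v ^ 2 * a - m ^ 2) / (2 * (1 + a))) *
        Real.exp (-b * (g - (v * a + m) / (1 + a)) ^ 2) := by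
    intro v g
    rw [← Real.exp_add, ← Real.exp_add]
    congr 1
    rw [hb]
    field_simp
    ring
  set F : ℝ → ℝ → ℝ≥0∞ := fun v g =>
    ENNReal.ofReal (Real.exp (g * v - g ^ 2 / 2)) *
      ENNReal.ofReal (Real.exp (-(1 / (2 * a)) * (g - m) ^ 2)) with hF
  have h1 : ∀ v, ∫⁻ g, F v g = ENNReal.ofReal
      (Real.exp ((2 * v * m + v ^ 2 * a - m ^ 2) / (2 * (1 + a)))) *
        ENNReal.ofReal √(Real.pi / b) := by
    intro v
    simp only [hF]
    simp_rw [← ENNReal.ofReal_mul (Real.exp_nonneg _), hpt,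
      ENNReal.ofReal_mul (Real.exp_nonneg _)]
    rw [lintegral_const_mul _ (by fun_prop), lintegral_gaussian hb0]
  have hmeas : Measurable (Function.uncurry F) := by
    simp only [hF]
    unfold Function.uncurry
    fun_prop
  have h2 : ∫⁻ v, ∫⁻ g, F v g ∂volume ∂μ ≤ ENNReal.ofReal √(Real.pi / (1 / (2 * a))) := by
    rw [lintegral_lintegral_swap hmeas.aemeasurable]
    calc _ ≤ ∫⁻ g : ℝ, ENNReal.ofReal (Real.exp (-(1 / (2 * a)) * (g - m) ^ 2)) := by
          refine lintegral_mono fun g => ?_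
          simp only [hF]
          rw [lintegral_mul_const _ (by fun_prop)]
          exact mul_le_of_le_one_left zero_le (lintegral_exp_le_one hμ g)
      _ = _ := lintegral_gaussian (by positivity) m
  simp only [h1] at h2
  rw [lintegral_mul_const _ (by fun_prop)] at h2
  have hs : 0 < √(Real.pi / b) := by positivity
  have h3 : √(Real.pi / (1 / (2 * a))) = √(1 + a) * √(Real.pi / b) := by
    rw [← Real.sqrt_mul (by positivity), hb]
    congr 1
    field_simp
  rw [h3, ENNReal.ofReal_mul (by positivity)] at h2
  exact (ENNReal.mul_le_mul_iff_left (by simpa using hs) ENNReal.ofReal_ne_top).mp h2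

variable {ι : Type*} [Fintype ι] [DecidableEq ι] {ν : ι → Measure ℝ}
  [∀ i, IsProbabilityMeasure (ν i)]

/-- A substitute for conditional expectation: a comparison after integrating one coordinate survives
integration over the others. -/
lemma lintegral_pi_le_of_update {f g : (ι → ℝ) → ℝ≥0∞} (hf : Measurable f) (hg : Measurable g)
    (k : ι) (h : ∀ e, ∫⁻ v, f (Function.update e k v) ∂ν k ≤
      ∫⁻ v, g (Function.update e k v) ∂ν k) :
    ∫⁻ e, f e ∂Measure.pi ν ≤ ∫⁻ e, g e ∂Measure.pi ν := by
  have h1 := lmarginal_le_of_subset (μ := ν) (Finset.subset_univ {k}) hf hg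
    (by rw [lmarginal_singleton, lmarginal_singleton]; exact h)
  rw [lmarginal_univ, lmarginal_univ] at h1
  exact h1 0

/-- If a coefficient `c k` can be nonzero only where the noise of index `k` does not influence the
coefficients, then the exponential moment bound of independent noises persists. -/
lemma lintegral_exp_sum_le_one (hν : ∀ i, HasSubgaussianMGF id 1 (ν i))
    {c : (ι → ℝ) → ι → ℝ} (hc : Measurable c)
    (h : ∀ e k v, c e k ≠ 0 → c (Function.update e k v) = c e) :
    ∫⁻ e, ENNReal.ofReal (Real.exp (∑ s, (c e s * e s - c e s ^ 2 / 2))) ∂Measure.pi ν ≤ 1 := by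
  have hc' : ∀ i, Measurable fun e => c e i := measurable_pi_iff.mp hc
  have hm : ∀ S : Finset ι, Measurable fun e : ι → ℝ =>
      ENNReal.ofReal (Real.exp (∑ s ∈ S, (c e s * e s - c e s ^ 2 / 2))) := fun S =>
    (Finset.measurable_fun_sum S fun i _ => ((hc' i).mul (measurable_pi_apply i)).sub
      (((hc' i).pow_const 2).div_const 2)).exp.ennreal_ofReal
  suffices H : ∀ S : Finset ι, ∫⁻ e, ENNReal.ofReal
      (Real.exp (∑ s ∈ S, (c e s * e s - c e s ^ 2 / 2))) ∂Measure.pi ν ≤ 1 from H Finset.univ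
  intro S
  induction S using Finset.induction_on with
  | empty => simp
  | insert k S hk ih =>
    refine le_trans (lintegral_pi_le_of_update (hm _) (hm S) k fun e => ?_) ih
    -- If coefficient `k` is nonzero at one point of the line in direction `k`, all coefficients are
    -- constant along this line and the factor of index `k` integrates to at most `1`. Otherwise
    -- that factor is identically `1`.
    by_cases hex : ∃ v, c (Function.update e k v) k ≠ 0
    · obtain ⟨v₀, hv₀⟩ := hex
      set c₀ := c (Function.update e k v₀) with hc₀
      have hconst : ∀ v, c (Function.update e k v) = c₀ := fun v => by
        have := h _ k v hv₀
        rwa [Function.update_idem] at this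
      have hS : ∀ v, ∑ s ∈ S, (c₀ s * Function.update e k v s - c₀ s ^ 2 / 2) = ∑ s ∈ S, (c₀ s * e s - c₀ s ^ 2 / 2) := fun v =>
        Finset.sum_congr rfl fun s hs => by
          rw [Function.update_of_ne (by rintro rfl; exact hk hs)]
      simp only [Finset.sum_insert hk, Function.update_self, hconst, hS]
      simp_rw [Real.exp_add, ENNReal.ofReal_mul (Real.exp_nonneg _)]
      rw [lintegral_mul_const _ (by fun_prop), lintegral_const, measure_univ, mul_one]
      exact mul_le_of_le_one_left zero_le (lintegral_exp_le_one (hν k) (c₀ k))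
    · push Not at hex
      refine le_of_eq (lintegral_congr fun v => ?_)
      rw [Finset.sum_insert hk, hex v]
      simp

end SubGaussian

/-! ### Tail bounds for the noise of a layer, with fixed contexts -/

section Tail

/-- Extension of a finite sequence by zero. -/
def extend {β : Type*} [Zero β] {T : ℕ} (e : Fin T → β) (t : ℕ) : β :=
  if h : t < T then e ⟨t, h⟩ else 0

lemma extend_coe {β : Type*} [Zero β] {T : ℕ} (e : Fin T → β) (t : Fin T) :
    extend e t = e t := by
  simp [extend]

lemma extend_update_of_ne {β : Type*} [Zero β] {T : ℕ} (e : Fin T → β) (k : Fin T) (v : β)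
    {t : ℕ} (ht : t ≠ k) : extend (Function.update e k v) t = extend e t := by
  unfold extend
  split_ifs with h
  · rw [Function.update_of_ne]
    rintro rfl
    exact ht rfl
  · rfl

lemma extend_update_self {β : Type*} [Zero β] {T : ℕ} (e : Fin T → β) (k : Fin T) (v : β) :
    extend (Function.update e k v) k = v := by
  simp [extend]

lemma measurable_extend {β : Type*} [Zero β] [MeasurableSpace β] {T : ℕ} (t : ℕ) :
    Measurable fun e : Fin T → β => extend e t := by
  unfold extend
  split_ifs
  · exact measurable_pi_apply _
  · exact measurable_const

lemma measure_le_of_lintegral_exp_le_one {α : Type*} [MeasurableSpace α] {μ : Measure α}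
    {f : α → ℝ} (hf : Measurable f) (h : ∫⁻ a, ENNReal.ofReal (Real.exp (f a)) ∂μ ≤ 1)
    {S : Set α} {b : ℝ} (hS : ∀ a ∈ S, b ≤ f a) : μ S ≤ ENNReal.ofReal (Real.exp (-b)) := by
  have h1 : S ⊆ {a | ENNReal.ofReal (Real.exp b) ≤ ENNReal.ofReal (Real.exp (f a))} :=
    fun a ha => ENNReal.ofReal_le_ofReal (Real.exp_le_exp.mpr (hS a ha))
  have h2 := (mul_meas_ge_le_lintegral hf.exp.ennreal_ofReal (μ := μ)
    (ENNReal.ofReal (Real.exp b))).trans h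
  have h3 := (mul_le_mul_right (measure_mono h1 (μ := μ)) (ENNReal.ofReal (Real.exp b))).trans h2
  have h4 : ENNReal.ofReal (Real.exp (-b)) * ENNReal.ofReal (Real.exp b) = 1 := by
    rw [← ENNReal.ofReal_mul (Real.exp_nonneg _), ← Real.exp_add]
    simp
  calc μ S = ENNReal.ofReal (Real.exp (-b)) * (ENNReal.ofReal (Real.exp b) * μ S) := by
        rw [← mul_assoc, h4, one_mul]
    _ ≤ ENNReal.ofReal (Real.exp (-b)) * 1 := by gcongr
    _ = _ := mul_one _

variable {d K : ℕ} (T : ℕ) (δ C : ℝ) (rule : SelectionRule d K) (θ : Vec d)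
  (x : ℕ → Contexts d K) {ν : Fin T → Measure ℝ} [∀ i, IsProbabilityMeasure (ν i)]

/-- The normalization `b / √q` is a function of the information matrix, hence as insensitive to the
noise of layer `κ` as the coefficients themselves, and it makes the squared coefficients sum to at
most `b²`. The sign `σ` serves both tails. -/
lemma measure_linear_tail_le (hν : ∀ i, HasSubgaussianMGF id 1 (ν i)) {κ n : ℕ} (hκ : 0 < κ)
    (hκ' : κ < lastLayer d) (hn : n ≤ T) (u : Fin d → ℝ) {b σ : ℝ} (hb : 0 ≤ b)
    (hσ : σ ^ 2 = 1) :
    Measure.pi ν {e | b * √(quad (info T δ C rule θ x (extend e) κ n) u u) <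
      σ * quad (info T δ C rule θ x (extend e) κ n) u
        (noiseSum T δ C rule θ x (extend e) κ n)} ≤ ENNReal.ofReal (Real.exp (-(b ^ 2 / 2))) := by
  set q : (Fin T → ℝ) → ℝ := fun e => quad (info T δ C rule θ x (extend e) κ n) u u with hq
  set c : (Fin T → ℝ) → Fin T → ℝ := fun e s =>
    σ * b / √(q e) * noiseCoeff T δ C rule θ x (extend e) κ n u s with hc
  have hx : ∀ t, Measurable fun _ : Fin T → ℝ => x t := fun t => measurable_const
  have hε : ∀ t, Measurable fun e : Fin T → ℝ => extend e t := measurable_extend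
  have hqm : Measurable q :=
    measurable_quad (measurable_info T δ C rule θ hx hε κ n) measurable_const measurable_const
  have hcm : Measurable c := by
    refine measurable_pi_iff.mpr fun s => (measurable_const.div hqm.sqrt).mul ?_
    refine Measurable.ite (measurableSet_setOfPred.mpr
      (measurable_const.and (measurable_layerAt_eq T δ C rule θ hx hε κ s))) ?_ measurable_const
    exact measurable_quad (measurable_info T δ C rule θ hx hε κ n) measurable_const
      (measurable_played T δ C rule θ hx hε s)
  have hinv : ∀ e k v, c e k ≠ 0 → c (Function.update e k v) = c e := by
    intro e k v hne
    have h1 : noiseCoeff T δ C rule θ x (extend e) κ n u k ≠ 0 := right_ne_zero_of_mul hne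
    have h2 : layerAt T δ C rule θ x (extend e) k = κ := by
      by_contra h
      exact h1 (if_neg fun h' => h h'.2)
    obtain ⟨h3, h4⟩ := noiseCoeff_congr T δ C rule θ x (extend e)
      (extend (Function.update e k v)) hκ hκ' h2
      (fun t ht => (extend_update_of_ne e k v ht).symm) n u
    funext s
    simp only [hc, hq]
    rw [h3, h4]
  refine measure_le_of_lintegral_exp_le_one ?_ (lintegral_exp_sum_le_one hν hcm hinv) ?_
  · have hc' : ∀ i, Measurable fun e => c e i := measurable_pi_iff.mp hcm
    exact Finset.measurable_fun_sum _ fun i _ => ((hc' i).mul (measurable_pi_apply i)).sub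
      (((hc' i).pow_const 2).div_const 2)
  · intro e he
    set Q := quad (info T δ C rule θ x (extend e) κ n) u
        (noiseSum T δ C rule θ x (extend e) κ n) with hQ
    have he' : b * √(q e) < σ * Q := he
    have hP := posDef_info T δ C rule θ x (extend e) κ n
    have hq0 : 0 ≤ q e := quad_self_nonneg hP u
    -- If `q e = 0`, Cauchy–Schwarz forces `Q = 0`, against the strict inequality `he'`; so the
    -- division in `c` is a genuine one on this event.
    have hqpos : 0 < √(q e) := by
      rcases (Real.sqrt_nonneg (q e)).eq_or_lt with h0 | h0
      · have h1 : |Q| ≤ √(q e) * _ := abs_quad_le hP u _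
        rw [← h0, zero_mul] at h1
        rw [abs_nonpos_iff.mp h1, ← h0] at he'
        simp at he'
      · exact h0
    have h1 : ∑ s : Fin T, noiseCoeff T δ C rule θ x (extend e) κ n u s * e s = Q := by
      rw [hQ, quad_noiseSum_eq T δ C rule θ x (extend e) hn, Finset.sum_range]
      exact Finset.sum_congr rfl fun s _ => by rw [extend_coe]
    have h2 : ∑ s : Fin T, noiseCoeff T δ C rule θ x (extend e) κ n u s ^ 2 ≤ q e := by
      have := sum_noiseCoeff_sq_le T δ C rule θ x (extend e) (κ := κ) hn u
      rwa [Finset.sum_range] at this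
    have h3 : ∑ s, (c e s * e s - c e s ^ 2 / 2) = b / √(q e) * (σ * Q) -
        (b / √(q e)) ^ 2 / 2 *
          ∑ s : Fin T, noiseCoeff T δ C rule θ x (extend e) κ n u s ^ 2 := by
      rw [Finset.sum_sub_distrib, ← h1, Finset.mul_sum, Finset.mul_sum, Finset.mul_sum]
      refine congrArg₂ _ (Finset.sum_congr rfl fun s _ => ?_)
        (Finset.sum_congr rfl fun s _ => ?_)
      · simp only [hc]; ring
      · simp only [hc, mul_pow, div_pow, hσ]; ring
    rw [h3]
    have h4 : b ^ 2 ≤ b / √(q e) * (σ * Q) := by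
      calc b ^ 2 = b / √(q e) * (b * √(q e)) := by field_simp
        _ ≤ _ := mul_le_mul_of_nonneg_left he'.le (by positivity)
    have h5 : (b / √(q e)) ^ 2 / 2 *
        ∑ s : Fin T, noiseCoeff T δ C rule θ x (extend e) κ n u s ^ 2 ≤ b ^ 2 / 2 := by
      calc _ ≤ (b / √(q e)) ^ 2 / 2 * √(q e) ^ 2 := by
            rw [Real.sq_sqrt hq0]
            exact mul_le_mul_of_nonneg_left h2 (by positivity)
        _ = _ := by field_simp
    linarith

/-- The logarithm of the self-normalized supermartingale of a layer. -/
def logMixture (ε : ℕ → ℝ) (κ n : ℕ) : ℝ :=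
  quad (info T δ C rule θ x ε κ n) (noiseSum T δ C rule θ x ε κ n)
    (noiseSum T δ C rule θ x ε κ n) / 2 - Real.log (info T δ C rule θ x ε κ n).det / 2

lemma layerAt_congr {ε ε' : ℕ → ℝ} {n : ℕ} (h : ∀ t < n, ε t = ε' t) :
    layerAt T δ C rule θ x ε n = layerAt T δ C rule θ x ε' n := by
  unfold layerAt
  rw [run_congr T δ C rule θ x ε ε' (fun _ _ => rfl) h]

lemma played_congr {ε ε' : ℕ → ℝ} {n : ℕ} (h : ∀ t < n, ε t = ε' t) :
    played T δ C rule θ x ε n = played T δ C rule θ x ε' n := by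
  unfold played policyAt
  rw [run_congr T δ C rule θ x ε ε' (fun _ _ => rfl) h]

lemma info_congr {ε ε' : ℕ → ℝ} {n : ℕ} (h : ∀ t < n, ε t = ε' t) (κ : ℕ) :
    info T δ C rule θ x ε κ n = info T δ C rule θ x ε' κ n := by
  unfold info
  rw [run_congr T δ C rule θ x ε ε' (fun _ _ => rfl) h]

lemma noiseSum_congr {ε ε' : ℕ → ℝ} {n : ℕ} (h : ∀ t < n, ε t = ε' t) (κ : ℕ) :
    noiseSum T δ C rule θ x ε κ n = noiseSum T δ C rule θ x ε' κ n := by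
  refine Finset.sum_congr rfl fun s hs => ?_
  have hs' : s < n := Finset.mem_range.mp hs
  have h' : ∀ t < s, ε t = ε' t := fun t ht => h t (by omega)
  rw [layerAt_congr T δ C rule θ x h', played_congr T δ C rule θ x h', h s hs']

lemma logMixture_succ_of_ne {ε : ℕ → ℝ} {κ n : ℕ}
    (hl : layerAt T δ C rule θ x ε n ≠ κ) :
    logMixture T δ C rule θ x ε κ (n + 1) = logMixture T δ C rule θ x ε κ n := by
  unfold logMixture
  rw [info_succ, noiseSum_succ, if_neg hl, if_neg hl, add_zero]

/-- The increment is the exponent of `lintegral_exp_mixture_le` minus the logarithm of the bound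
there, which makes the exponential a supermartingale. -/
lemma logMixture_succ_of_eq {ε : ℕ → ℝ} {κ n : ℕ} {a m : ℝ}
    (hl : layerAt T δ C rule θ x ε n = κ)
    (ha : a = quad (info T δ C rule θ x ε κ n) (played T δ C rule θ x ε n).ofLp
      (played T δ C rule θ x ε n).ofLp)
    (hm : m = quad (info T δ C rule θ x ε κ n) (played T δ C rule θ x ε n).ofLp
      (noiseSum T δ C rule θ x ε κ n)) :
    logMixture T δ C rule θ x ε κ (n + 1) = logMixture T δ C rule θ x ε κ n +
      (2 * ε n * m + ε n ^ 2 * a - m ^ 2) / (2 * (1 + a)) - Real.log (1 + a) / 2 := by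
  have hP := posDef_info T δ C rule θ x ε κ n
  have ha0 : 0 ≤ a := ha ▸ quad_self_nonneg hP _
  unfold logMixture
  rw [info_succ, noiseSum_succ, if_pos hl, if_pos hl, det_add_vecMulVec hP, ← ha,
    Real.log_mul hP.det_pos.ne' (by linarith), quad_add_vecMulVec hP]
  simp only [quad_add_left, quad_add_right, quad_smul_left, quad_smul_right, ← ha, ← hm,
    quad_comm hP (noiseSum T δ C rule θ x ε κ n) (played T δ C rule θ x ε n).ofLp]
  field_simp
  ring

lemma lintegral_exp_logMixture_le_one (hν : ∀ i, HasSubgaussianMGF id 1 (ν i)) (κ n : ℕ)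
    (hn : n ≤ T) :
    ∫⁻ e, ENNReal.ofReal (Real.exp (logMixture T δ C rule θ x (extend e) κ n)) ∂Measure.pi ν ≤
      1 := by
  have hx : ∀ t, Measurable fun _ : Fin T → ℝ => x t := fun t => measurable_const
  have hε : ∀ t, Measurable fun e : Fin T → ℝ => extend e t := measurable_extend
  have hmeas : ∀ n, Measurable fun e : Fin T → ℝ =>
      ENNReal.ofReal (Real.exp (logMixture T δ C rule θ x (extend e) κ n)) := fun n =>
    (((measurable_quad (measurable_info T δ C rule θ hx hε κ n)
      (measurable_noiseSum T δ C rule θ hx hε κ n)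
      (measurable_noiseSum T δ C rule θ hx hε κ n)).div_const 2).sub
      ((measurable_matrix_det (measurable_info T δ C rule θ hx hε κ n)).log.div_const
        2)).exp.ennreal_ofReal
  induction n with
  | zero => simp [logMixture, info_zero, noiseSum, quad]
  | succ n ih =>
    -- Only the noise of round `n` is integrated out: layer, arm, matrix and noise sum are
    -- determined by the earlier ones.
    refine le_trans (lintegral_pi_le_of_update (hmeas _) (hmeas n) ⟨n, hn⟩ fun e => ?_)
      (ih (by omega))
    have hagree : ∀ v, ∀ t < n, extend (Function.update e (⟨n, hn⟩ : Fin T) v) t = extend e t :=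
      fun v t ht => extend_update_of_ne e _ v (by simpa using ht.ne)
    have hW : ∀ v, logMixture T δ C rule θ x (extend (Function.update e ⟨n, hn⟩ v)) κ n =
        logMixture T δ C rule θ x (extend e) κ n := fun v => by
      unfold logMixture
      rw [info_congr T δ C rule θ x (hagree v), noiseSum_congr T δ C rule θ x (hagree v)]
    by_cases hl : layerAt T δ C rule θ x (extend e) n = κ
    · set a := quad (info T δ C rule θ x (extend e) κ n)
        (played T δ C rule θ x (extend e) n).ofLp (played T δ C rule θ x (extend e) n).ofLp
      set m := quad (info T δ C rule θ x (extend e) κ n)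
        (played T δ C rule θ x (extend e) n).ofLp (noiseSum T δ C rule θ x (extend e) κ n)
      have ha : 0 ≤ a := quad_self_nonneg (posDef_info T δ C rule θ x (extend e) κ n) _
      have hstep : ∀ v, logMixture T δ C rule θ x (extend (Function.update e ⟨n, hn⟩ v)) κ
          (n + 1) = (logMixture T δ C rule θ x (extend e) κ n - Real.log (1 + a) / 2) +
            (2 * v * m + v ^ 2 * a - m ^ 2) / (2 * (1 + a)) := fun v => by
        have hv : extend (Function.update e (⟨n, hn⟩ : Fin T) v) n = v :=
          extend_update_self e ⟨n, hn⟩ v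
        rw [logMixture_succ_of_eq T δ C rule θ x (a := a) (m := m)
          (by rw [layerAt_congr T δ C rule θ x (hagree v), hl])
          (by rw [info_congr T δ C rule θ x (hagree v), played_congr T δ C rule θ x (hagree v)])
          (by rw [info_congr T δ C rule θ x (hagree v), played_congr T δ C rule θ x (hagree v),
            noiseSum_congr T δ C rule θ x (hagree v)]), hW, hv]
        ring
      simp only [hstep, hW]
      simp_rw [Real.exp_add, ENNReal.ofReal_mul (Real.exp_nonneg _)]
      rw [lintegral_const_mul _ (by fun_prop), lintegral_const, measure_univ, mul_one]
      refine (mul_le_mul_right (lintegral_exp_mixture_le (hν ⟨n, hn⟩) ha m) _).trans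
        (le_of_eq ?_)
      rw [← ENNReal.ofReal_mul (Real.exp_nonneg _), Real.exp_sub, ← Real.log_sqrt (by linarith),
        Real.exp_log (Real.sqrt_pos.mpr (by linarith)),
        div_mul_cancel₀ _ (Real.sqrt_pos.mpr (by linarith)).ne']
    · refine le_of_eq (lintegral_congr fun v => ?_)
      rw [logMixture_succ_of_ne]
      rwa [layerAt_congr T δ C rule θ x (hagree v)]

lemma measure_selfNormalized_tail_le (hν : ∀ i, HasSubgaussianMGF id 1 (ν i)) (hd : 2 ≤ d)
    (hT : 2 ≤ T) (hx : ∀ t < T, ∀ i, ‖x t i‖ ≤ 1) (κ n : ℕ) (hn : n ≤ T) {b : ℝ} (hb : 0 ≤ b) :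
    Measure.pi ν {e | b < √(quad (info T δ C rule θ x (extend e) κ n)
        (noiseSum T δ C rule θ x (extend e) κ n) (noiseSum T δ C rule θ x (extend e) κ n))} ≤
      ENNReal.ofReal (Real.exp (-(b ^ 2 / 2 - d * Real.log T / 2))) := by
  have hx' : ∀ t, Measurable fun _ : Fin T → ℝ => x t := fun t => measurable_const
  have hε : ∀ t, Measurable fun e : Fin T → ℝ => extend e t := measurable_extend
  refine measure_le_of_lintegral_exp_le_one (f := fun e =>
    logMixture T δ C rule θ x (extend e) κ n) ?_
    (lintegral_exp_logMixture_le_one T δ C rule θ x hν κ n hn) ?_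
  · exact ((measurable_quad (measurable_info T δ C rule θ hx' hε κ n)
      (measurable_noiseSum T δ C rule θ hx' hε κ n)
      (measurable_noiseSum T δ C rule θ hx' hε κ n)).div_const 2).sub
      ((measurable_matrix_det (measurable_info T δ C rule θ hx' hε κ n)).log.div_const 2)
  · intro e he
    have h1 : b ^ 2 < _ := (Real.lt_sqrt hb).mp he
    have h2 := Real.log_le_log (posDef_info T δ C rule θ x (extend e) κ n).det_pos
      (det_info_le T δ C rule θ x (extend e) hd hT hx κ n hn)
    rw [Real.log_pow] at h2
    unfold logMixture
    linarith

end Tail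

/-! ### The failure event and the union bound -/

section Failure

variable {d K : ℕ} (T : ℕ) (δ C : ℝ) (rule : SelectionRule d K) (θ : Vec d)
  (x : ℕ → Contexts d K) (ε : ℕ → ℝ)

/-- The event that the noise leaves the confidence region of some layer. -/
def Failure : Prop :=
  (∃ s < T, alpha d K T δ 0 - 1 < √(quad (info T δ C rule θ x ε 0 s)
    (noiseSum T δ C rule θ x ε 0 s) (noiseSum T δ C rule θ x ε 0 s))) ∨
  ∃ κ < lastLayer d, 0 < κ ∧ ∃ s < T, ∃ t < T, ∃ i,
    (alpha d K T δ κ - 1) * √(quad (info T δ C rule θ x ε κ s) (x t i).ofLp (x t i).ofLp) <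
      |quad (info T δ C rule θ x ε κ s) (x t i).ofLp (noiseSum T δ C rule θ x ε κ s)|

lemma confident_of_not_failure (hθ : ‖θ‖ ≤ 1) (h : ¬ Failure T δ C rule θ x ε) (t : ℕ)
    (ht : t < T) : Confident T δ (run T δ C rule θ x ε t).frozen (x t) θ := by
  simp only [Failure, not_or, not_exists, not_and, not_lt] at h
  obtain ⟨h0, h1⟩ := h
  intro κ hκ i
  obtain ⟨s, hs, hfr⟩ := exists_frozen_eq_cur T δ C rule θ x ε κ t
  have hP := posDef_info T δ C rule θ x ε κ s
  rw [width_eq, rhat, hfr, estimate_cur]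
  change _ ≤ _ * √(quad (info T δ C rule θ x ε κ s) (x t i).ofLp (x t i).ofLp)
  set w := √(quad (info T δ C rule θ x ε κ s) (x t i).ofLp (x t i).ofLp) with hw
  have hw0 : 0 ≤ w := Real.sqrt_nonneg _
  -- The ridge bias is at most one width unit; this is the `1` subtracted from `α_κ` in `Failure`.
  have h2 : |quad (info T δ C rule θ x ε κ s) (x t i).ofLp θ.ofLp| ≤ w := by
    refine (abs_quad_le hP _ _).trans (mul_le_of_le_one_right hw0 ?_)
    rw [← Real.sqrt_one]
    exact Real.sqrt_le_sqrt ((quad_info_le T δ C rule θ x ε κ s _).trans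
      (dotProduct_self_le_one hθ))
  have h3 : |quad (info T δ C rule θ x ε κ s) (x t i).ofLp (noiseSum T δ C rule θ x ε κ s)| ≤
      (alpha d K T δ κ - 1) * w := by
    rcases Nat.eq_zero_or_pos κ with rfl | hpos
    · refine (abs_quad_le hP _ _).trans ?_
      rw [mul_comm]
      exact mul_le_mul_of_nonneg_right (h0 s (by omega)) hw0
    · exact h1 κ hκ hpos s (by omega) t ht i
  refine (abs_sub _ _).trans ?_
  linarith

lemma measurable_failure {α : Type*} [MeasurableSpace α] {x : ℕ → α → Contexts d K}
    {ε : ℕ → α → ℝ} (hx : ∀ t, Measurable (x t)) (hε : ∀ t, Measurable (ε t)) :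
    Measurable fun a => Failure T δ C rule θ (fun t => x t a) (fun t => ε t a) := by
  have hi := measurable_info T δ C rule θ hx hε
  have hn := measurable_noiseSum T δ C rule θ hx hε
  have hv : ∀ t i, Measurable fun a => (x t a i).ofLp := fun t i =>
    measurable_ofLp_vec (measurable_pi_iff.mp (hx t) i)
  refine (Measurable.exists fun s => measurable_const.and
    (measurable_prop_lt measurable_const (measurable_quad (hi 0 s) (hn 0 s) (hn 0 s)).sqrt)).or
    (Measurable.exists fun κ => measurable_const.and (measurable_const.and
      (Measurable.exists fun s => measurable_const.and (Measurable.exists fun t =>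
        measurable_const.and (Measurable.exists fun i => measurable_prop_lt
          ((measurable_quad (hi κ s) (hv t i) (hv t i)).sqrt.const_mul _)
          (measurable_quad (hi κ s) (hv t i) (hn κ s)).abs)))))

variable {T δ}

/-- The target `δ / T²` leaves `δ / T` after a union over `T` rounds. -/
lemma exp_alpha_zero_le (hd : 2 ≤ d) (hT : 2 ≤ T) (hδ : 0 < δ) (hδ1 : δ < 1) :
    0 ≤ alpha d K T δ 0 - 1 ∧
      Real.exp (-((alpha d K T δ 0 - 1) ^ 2 / 2 - d * Real.log T / 2)) ≤ δ / T ^ 2 := by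
  have hd' : (2 : ℝ) ≤ d := by exact_mod_cast hd
  have hT' : (2 : ℝ) ≤ T := by exact_mod_cast hT
  have hlog : Real.log (2 * T / δ) = Real.log 2 + Real.log T - Real.log δ := by
    rw [Real.log_div (by positivity) hδ.ne', Real.log_mul (by norm_num) (by positivity)]
  have h2 := Real.log_two_gt_d9
  have hlT : Real.log 2 ≤ Real.log T := Real.log_le_log (by norm_num) hT'
  have hlδ : Real.log δ < 0 := Real.log_neg hδ hδ1
  have hL : 2 ≤ d * Real.log (2 * T / δ) := by
    rw [hlog]; nlinarith
  set r := √(d * Real.log (2 * T / δ)) with hr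
  have hr2 : r ^ 2 = d * Real.log (2 * T / δ) := Real.sq_sqrt (by linarith)
  have hr0 : 0 ≤ r := Real.sqrt_nonneg _
  have hα : alpha d K T δ 0 = 2 * r := rfl
  rw [hα]
  refine ⟨by nlinarith, ?_⟩
  have hrhs : δ / (T : ℝ) ^ 2 = Real.exp (Real.log δ - 2 * Real.log T) := by
    have h : 2 * Real.log T = Real.log ((T : ℝ) ^ 2) := by simp [Real.log_pow]
    rw [Real.exp_sub, Real.exp_log hδ, h, Real.exp_log (by positivity)]
  rw [hrhs, Real.exp_le_exp]
  rw [hlog] at hr2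
  -- This gives `2 r ≤ r² / 2 + 2`, hence `(2 r - 1)² / 2 ≥ 3 (r² - 1) / 2`.
  have h3 : 0 ≤ (r - 2) ^ 2 := sq_nonneg _
  have h4 : 0 ≤ (d - 2) * Real.log T := mul_nonneg (by linarith) (by linarith)
  have h5 : 0 ≤ (d - 2) * Real.log 2 := mul_nonneg (by linarith) (by linarith)
  have h6 : 0 ≤ (d - 2) * -Real.log δ := mul_nonneg (by linarith) (by linarith)
  nlinarith

/-- The prefactor bounds the number of events: two signs, at most `d` layers, `K` arms and `T²`
pairs of a freezing time and a round. -/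
lemma exp_alpha_succ_le (hd : 2 ≤ d) (hK : 1 ≤ K) (hT : 2 ≤ T) (hδ : 0 < δ) (hδ1 : δ < 1)
    {κ : ℕ} (hκ : 0 < κ) :
    0 ≤ alpha d K T δ κ - 1 ∧
      2 * d * K * T ^ 2 * Real.exp (-((alpha d K T δ κ - 1) ^ 2 / 2)) ≤ δ / T := by
  have hd' : (2 : ℝ) ≤ d := by exact_mod_cast hd
  have hK' : (1 : ℝ) ≤ K := by exact_mod_cast hK
  have hT' : (2 : ℝ) ≤ T := by exact_mod_cast hT
  have hr := four_le_ratio hd hK hT hδ hδ1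
  set y : ℝ := 2 * d * K * T / δ with hy
  have hy8 : 8 ≤ y := by
    have : y = 2 * (d * K * T / δ) := by rw [hy]; ring
    linarith
  have hL : 1 ≤ Real.log y := by
    rw [Real.le_log_iff_exp_le (by linarith)]
    linarith [Real.exp_one_lt_d9]
  set r := √(Real.log y) with hr
  have hr2 : r ^ 2 = Real.log y := Real.sq_sqrt (by linarith)
  have hr1 : 1 ≤ r := Real.one_le_sqrt.mpr hL
  obtain ⟨j, rfl⟩ : ∃ j, κ = j + 1 := ⟨κ - 1, by omega⟩
  have hα : alpha d K T δ (j + 1) = 10 * r := rfl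
  rw [hα]
  refine ⟨by linarith, ?_⟩
  have h1 : Real.exp (-((10 * r - 1) ^ 2 / 2)) ≤ 1 / y ^ 3 := by
    have : 1 / y ^ 3 = Real.exp (-(3 * Real.log y)) := by
      have h : 3 * Real.log y = Real.log (y ^ 3) := by simp [Real.log_pow]
      rw [Real.exp_neg, h, Real.exp_log (by positivity), one_div]
    rw [this, Real.exp_le_exp, ← hr2]
    nlinarith
  refine (mul_le_mul_of_nonneg_left h1 (by positivity)).trans ?_
  have hδy : δ * y = 2 * d * K * T := by rw [hy]; field_simp
  rw [mul_one_div, div_le_div_iff₀ (by positivity) (by positivity)]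
  have h2 : (T : ℝ) ≤ y := by
    have h3 : (1 : ℝ) ≤ d * K := by nlinarith
    have h4 : (T : ℝ) ≤ δ * y := by rw [hδy]; nlinarith
    nlinarith
  calc 2 * (d : ℝ) * K * T ^ 2 * T = δ * y * T ^ 2 := by rw [hδy]; ring
    _ ≤ δ * y * y ^ 2 := by gcongr
    _ = δ * y ^ 3 := by ring

lemma lastLayer_le_self (hd : 2 ≤ d) : lastLayer d ≤ d := by
  refine Nat.ceil_le.mpr ?_
  rw [Real.logb_le_iff_le_rpow (by norm_num) (by positivity), Real.rpow_natCast]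
  exact_mod_cast Nat.lt_two_pow_self.le

/-- Layer `0` and the layers strictly between `0` and `κ₀` contribute `δ / T` each. The freezing
time is random, so the union runs over all its possible values. -/
lemma measure_failure_le {ν : Fin T → Measure ℝ} [∀ i, IsProbabilityMeasure (ν i)]
    (hν : ∀ i, HasSubgaussianMGF id 1 (ν i)) (hd : 2 ≤ d) (hK : 1 ≤ K) (hT : 2 ≤ T)
    (hδ : 0 < δ) (hδ1 : δ < 1) (hx : ∀ t < T, ∀ i, ‖x t i‖ ≤ 1) :
    Measure.pi ν {e | Failure T δ C rule θ x (extend e)} ≤ ENNReal.ofReal (2 * δ / T) := by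
  obtain ⟨ha0, ha⟩ := exp_alpha_zero_le (K := K) hd hT hδ hδ1
  set A : ℕ → Set (Fin T → ℝ) := fun s => {e | alpha d K T δ 0 - 1 <
    √(quad (info T δ C rule θ x (extend e) 0 s) (noiseSum T δ C rule θ x (extend e) 0 s)
      (noiseSum T δ C rule θ x (extend e) 0 s))} with hA
  set B : ℝ → ℕ × ℕ × ℕ × Fin K → Set (Fin T → ℝ) := fun σ p => {e | (alpha d K T δ p.1 - 1) *
      √(quad (info T δ C rule θ x (extend e) p.1 p.2.1) (x p.2.2.1 p.2.2.2).ofLp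
        (x p.2.2.1 p.2.2.2).ofLp) <
      σ * quad (info T δ C rule θ x (extend e) p.1 p.2.1) (x p.2.2.1 p.2.2.2).ofLp
        (noiseSum T δ C rule θ x (extend e) p.1 p.2.1)} with hB
  set I : Finset (ℕ × ℕ × ℕ × Fin K) :=
    Finset.Ico 1 (lastLayer d) ×ˢ Finset.range T ×ˢ Finset.range T ×ˢ Finset.univ with hI
  have hsub : {e | Failure T δ C rule θ x (extend e)} ⊆
      (⋃ s ∈ Finset.range T, A s) ∪ ⋃ p ∈ I, (B 1 p ∪ B (-1) p) := by
    rintro e (⟨s, hs, h⟩ | ⟨κ, hκ, hκ0, s, hs, t, ht, i, h⟩)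
    · exact Or.inl (Set.mem_biUnion (Finset.mem_range.mpr hs) h)
    · refine Or.inr (Set.mem_biUnion (x := (κ, s, t, i)) ?_ ?_)
      · simp only [hI, Finset.mem_coe, Finset.mem_product, Finset.mem_Ico, Finset.mem_range,
          Finset.mem_univ, and_true]
        exact ⟨⟨hκ0, hκ⟩, hs, ht⟩
      · rcases lt_abs.mp h with h' | h'
        · exact Or.inl (by simpa [hB] using h')
        · exact Or.inr (by simpa [hB] using h')
  have h1 : Measure.pi ν (⋃ s ∈ Finset.range T, A s) ≤ ENNReal.ofReal (δ / T) := by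
    refine (measure_biUnion_finset_le _ _).trans ((Finset.sum_le_sum fun s hs =>
      (measure_selfNormalized_tail_le T δ C rule θ x hν hd hT hx 0 s
        (Finset.mem_range.mp hs).le ha0).trans (ENNReal.ofReal_le_ofReal ha)).trans ?_)
    rw [Finset.sum_const, Finset.card_range, nsmul_eq_mul, ← ENNReal.ofReal_natCast,
      ← ENNReal.ofReal_mul (by positivity)]
    refine ENNReal.ofReal_le_ofReal (le_of_eq ?_)
    have hT' : (T : ℝ) ≠ 0 := by positivity
    field_simp
  have h2 : Measure.pi ν (⋃ p ∈ I, (B 1 p ∪ B (-1) p)) ≤ ENNReal.ofReal (δ / T) := by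
    obtain ⟨-, hb⟩ := exp_alpha_succ_le hd hK hT hδ hδ1 (κ := 1) one_pos
    set E := Real.exp (-((alpha d K T δ 1 - 1) ^ 2 / 2)) with hE
    have hBle : ∀ p ∈ I, Measure.pi ν (B 1 p ∪ B (-1) p) ≤ ENNReal.ofReal (2 * E) := by
      intro p hp
      simp only [hI, Finset.mem_product, Finset.mem_Ico, Finset.mem_range] at hp
      obtain ⟨⟨hp1, hp2⟩, hp3, -⟩ := hp
      have hb0 := (exp_alpha_succ_le hd hK hT hδ hδ1 hp1).1
      have hα : alpha d K T δ p.1 = alpha d K T δ 1 := by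
        obtain ⟨j, hj⟩ : ∃ j, p.1 = j + 1 := ⟨p.1 - 1, by omega⟩
        rw [hj]
        rfl
      have hσ : ∀ σ : ℝ, σ ^ 2 = 1 → Measure.pi ν (B σ p) ≤ ENNReal.ofReal E := fun σ hσ => by
        rw [hE, ← hα]
        exact measure_linear_tail_le T δ C rule θ x hν hp1 hp2 hp3.le _ hb0 hσ
      refine (measure_union_le _ _).trans ?_
      rw [two_mul, ENNReal.ofReal_add (Real.exp_nonneg _) (Real.exp_nonneg _)]
      exact add_le_add (hσ 1 (by norm_num)) (hσ (-1) (by norm_num))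
    refine (measure_biUnion_finset_le _ _).trans ((Finset.sum_le_sum hBle).trans ?_)
    rw [Finset.sum_const, nsmul_eq_mul, ← ENNReal.ofReal_natCast,
      ← ENNReal.ofReal_mul (by positivity)]
    refine ENNReal.ofReal_le_ofReal (le_trans ?_ hb)
    have hcard : (I.card : ℝ) ≤ d * (T * (T * K)) := by
      have : I.card ≤ d * (T * (T * K)) := by
        simp only [hI, Finset.card_product, Nat.card_Ico, Finset.card_range, Finset.card_univ,
          Fintype.card_fin]
        exact Nat.mul_le_mul_right _ ((Nat.sub_le _ _).trans (lastLayer_le_self hd))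
      exact_mod_cast this
    have hE0 : 0 ≤ E := Real.exp_nonneg _
    calc (I.card : ℝ) * (2 * E) ≤ d * (T * (T * K)) * (2 * E) := by gcongr
      _ = _ := by ring
  refine (measure_mono hsub).trans ((measure_union_le _ _).trans ((add_le_add h1 h2).trans ?_))
  rw [← ENNReal.ofReal_add (by positivity) (by positivity)]
  exact ENNReal.ofReal_le_ofReal (le_of_eq (by ring))

lemma regret_congr {x' : ℕ → Contexts d K} {ε' : ℕ → ℝ} (hx : ∀ t < T, x t = x' t)
    (hε : ∀ t < T, ε t = ε' t) :
    regret T δ C rule θ x ε = regret T δ C rule θ x' ε' := by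
  refine Finset.sum_congr rfl fun t ht => ?_
  have ht' : t < T := Finset.mem_range.mp ht
  unfold policyAt
  rw [run_congr T δ C rule θ x ε ε' (fun s hs => hx s (by omega))
    (fun s hs => hε s (by omega)), hx t ht']

end Failure

/-! ### Transfer to random contexts -/

section Bandit

variable {d K T : ℕ} {δ C : ℝ} {rule : SelectionRule d K} {θ : Vec d} {Ω : Type*}
  {X : ℕ → Ω → Contexts d K} {ε : ℕ → Ω → ℝ}

/-- The failure event of the bandit. -/
def failureSet (T : ℕ) (δ C : ℝ) (rule : SelectionRule d K) (θ : Vec d)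
    (X : ℕ → Ω → Contexts d K) (ε : ℕ → Ω → ℝ) : Set Ω :=
  {ω | Failure T δ C rule θ (extend fun t : Fin T => X t ω) (extend fun t : Fin T => ε t ω)}

lemma regret_le_of_notMem_failureSet (hd : 2 ≤ d) (hK : 1 ≤ K) (hT : 2 ≤ T) (hδ : 0 < δ)
    (hδ1 : δ < 1) (hC : 2 ≤ C) (hθ : ‖θ‖ ≤ 1) {ω : Ω} (hx : ∀ t < T, ∀ i, ‖X t ω i‖ ≤ 1)
    (hω : ω ∉ failureSet T δ C rule θ X ε) :
    regret T δ C rule θ (fun t => X t ω) (fun t => ε t ω) ≤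
      6408 * (C * √(d * T) * Real.logb 2 d * Real.logb 2 T *
              Real.logb 2 (d * K * T / δ)) := by
  rw [regret_congr C rule θ _ _ (x' := extend fun t : Fin T => X t ω)
    (ε' := extend fun t : Fin T => ε t ω) (fun t ht => by simp [extend, ht])
    (fun t ht => by simp [extend, ht])]
  exact regret_le_of_confident T δ C rule θ _ _ hd hK hT hδ hδ1 hC
    (fun t ht i => by simpa [extend, ht] using hx t ht i)
    (confident_of_not_failure T δ C rule θ _ _ hθ hω)

lemma one_le_regret_bound (hd : 2 ≤ d) (hK : 1 ≤ K) (hT : 2 ≤ T) (hδ : 0 < δ) (hδ1 : δ < 1)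
    (hC : 2 ≤ C) :
    1 ≤ C * √(d * T) * Real.logb 2 d * Real.logb 2 T * Real.logb 2 (d * K * T / δ) := by
  have h1 := one_le_logb_two hd
  have h2 := one_le_logb_two hT
  have h3 := two_le_logb_ratio hd hK hT hδ hδ1
  have h4 : 1 ≤ √((d : ℝ) * T) := Real.one_le_sqrt.mpr (by
    have : 1 ≤ d * T := Nat.one_le_iff_ne_zero.mpr (by positivity)
    exact_mod_cast this)
  have e1 : 1 ≤ C * √((d : ℝ) * T) := by nlinarith
  have e2 : 1 ≤ C * √((d : ℝ) * T) * Real.logb 2 d := by nlinarith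
  have e3 : 1 ≤ C * √((d : ℝ) * T) * Real.logb 2 d * Real.logb 2 T := by nlinarith
  nlinarith

variable [MeasurableSpace Ω]

lemma measurableSet_failureSet (hX : ∀ t < T, Measurable (X t)) (hε : ∀ t < T, Measurable (ε t)) :
    MeasurableSet (failureSet T δ C rule θ X ε) :=
  measurableSet_setOfPred.mpr (measurable_failure T δ C rule θ
    (x := fun t ω => extend (fun t : Fin T => X t ω) t)
    (ε := fun t ω => extend (fun t : Fin T => ε t ω) t)
    (fun t => (measurable_extend t).comp (measurable_pi_iff.mpr fun s => hX s s.2))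
    (fun t => (measurable_extend t).comp (measurable_pi_iff.mpr fun s => hε s s.2)))

/-- The joint law of contexts and noise is a product, so the bound for fixed contexts is integrated
over almost every context sequence. -/
lemma measure_failureSet_le {P : Measure Ω} [IsProbabilityMeasure P] (hd : 2 ≤ d) (hK : 1 ≤ K) (hT : 2 ≤ T) (hδ : 0 < δ) (hδ1 : δ < 1)
    (hX : ∀ t < T, Measurable (X t)) (hε : ∀ t < T, Measurable (ε t))
    (hbound : ∀ t < T, ∀ᵐ ω ∂P, ∀ i, ‖X t ω i‖ ≤ 1)
    (hεi : iIndepFun (fun t : Fin T => ε t) P)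
    (hsub : ∀ t < T, HasSubgaussianMGF (ε t) 1 P)
    (hXε : IndepFun (fun ω (t : Fin T) => X t ω) (fun ω (t : Fin T) => ε t ω) P) :
    P (failureSet T δ C rule θ X ε) ≤ ENNReal.ofReal (2 * δ / T) := by
  have hXm : Measurable fun ω (t : Fin T) => X t ω := measurable_pi_iff.mpr fun t => hX t t.2
  have hεm : Measurable fun ω (t : Fin T) => ε t ω := measurable_pi_iff.mpr fun t => hε t t.2
  have hpi := (iIndepFun_iff_map_fun_eq_pi_map
    (f := fun t : Fin T => ε t) fun t => (hε t t.2).aemeasurable).mp hεi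
  have hprod := (indepFun_iff_map_prod_eq_prod_map_map hXm.aemeasurable hεm.aemeasurable).mp hXε
  rw [hpi] at hprod
  have hprob : ∀ t : Fin T, IsProbabilityMeasure (P.map (ε t)) := fun t =>
    Measure.isProbabilityMeasure_map (hε t t.2).aemeasurable
  have hprobX : IsProbabilityMeasure (P.map fun ω (t : Fin T) => X t ω) :=
    Measure.isProbabilityMeasure_map hXm.aemeasurable
  set S : Set ((Fin T → Contexts d K) × (Fin T → ℝ)) :=
    {a | Failure T δ C rule θ (extend a.1) (extend a.2)} with hS
  have hSm : MeasurableSet S := measurableSet_setOfPred.mpr (measurable_failure T δ C rule θ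
    (x := fun t (a : (Fin T → Contexts d K) × (Fin T → ℝ)) => extend a.1 t)
    (ε := fun t a => extend a.2 t) (fun t => (measurable_extend t).comp measurable_fst)
    (fun t => (measurable_extend t).comp measurable_snd))
  have h1 : P (failureSet T δ C rule θ X ε) =
      P.map (fun ω => ((fun t : Fin T => X t ω), fun t : Fin T => ε t ω)) S :=
    (Measure.map_apply (hXm.prodMk hεm) hSm).symm
  rw [h1, hprod, Measure.prod_apply hSm]
  have hae : ∀ᵐ x ∂(P.map fun ω (t : Fin T) => X t ω), ∀ t i, ‖x t i‖ ≤ 1 := by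
    rw [ae_map_iff hXm.aemeasurable]
    · exact ae_all_iff.mpr fun t => hbound t t.2
    · refine measurableSet_setOfPred.mpr (Measurable.forall fun t => Measurable.forall fun i =>
        measurable_prop_le (Measurable.norm ?_) measurable_const)
      exact (measurable_pi_apply i).comp (measurable_pi_apply t)
  have hν : ∀ t : Fin T, HasSubgaussianMGF id 1 (P.map (ε t)) := fun t =>
    (HasSubgaussianMGF.id_map_iff (hε t t.2).aemeasurable).mpr (hsub t t.2)
  refine (lintegral_mono_ae (g := fun _ => ENNReal.ofReal (2 * δ / T)) ?_).trans (by simp)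
  filter_upwards [hae] with x hx
  refine measure_failure_le C rule θ (extend x) hν hd hK hT hδ hδ1 fun t ht i => ?_
  simpa [extend, ht] using hx ⟨t, ht⟩ i

end Bandit

end SupLin

end

theorem mainTheorem5 :
    ∃ c : ℝ, 0 < c ∧
      ∀ (d K T : ℕ) (_ : 2 ≤ d) (_ : 1 ≤ K) (_ : 2 ≤ T)
        (δ : ℝ) (_ : 0 < δ) (_ : δ < 1) (C : ℝ) (_ : 2 ≤ C)
        (rule : SupLin.SelectionRule d K)
        (θ : SupLin.Vec d) (_ : ‖θ‖ ≤ 1)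
        (Ω : Type*) [MeasurableSpace Ω] (P : Measure Ω) [IsProbabilityMeasure P]
        (X : ℕ → Ω → SupLin.Contexts d K) (ε : ℕ → Ω → ℝ)
        (_ : ∀ t < T, Measurable (X t)) (_ : ∀ t < T, Measurable (ε t))
        -- the contexts are independent over time, with arbitrary laws in the unit ball
        (_ : iIndepFun (fun t : Fin T => X t) P)
        (_ : ∀ t < T, ∀ᵐ ω ∂P, ∀ i, ‖X t ω i‖ ≤ 1)
        -- independent sub-Gaussian noise, independent of the contexts
        (_ : iIndepFun (fun t : Fin T => ε t) P)
        (_ : ∀ t < T, HasSubgaussianMGF (ε t) 1 P)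
        (_ : IndepFun (fun ω (t : Fin T) => X t ω) (fun ω (t : Fin T) => ε t ω) P),
        (∀ᵐ ω ∂P,
          (SupLin.numSwitches T δ C rule θ (fun t => X t ω) (fun t => ε t ω) : ℝ) ≤
            1 + c * (d * Real.logb 2 d * Real.logb 2 T / Real.logb 2 C)) ∧
        ENNReal.ofReal (1 - 2 * δ) ≤
          P {ω | SupLin.regret T δ C rule θ (fun t => X t ω) (fun t => ε t ω) ≤
            c * (C * √(d * T) * Real.logb 2 d * Real.logb 2 T *
              Real.logb 2 (d * K * T / δ))} ∧
        SupLin.highProbExpected P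
            (fun ω => SupLin.regret T δ C rule θ (fun t => X t ω) (fun t => ε t ω)) (2 * δ) ≤
          ENNReal.ofReal (c * (C * √(d * T) * Real.logb 2 d * Real.logb 2 T *
              Real.logb 2 (d * K * T / δ))) := by
  -- `6408` from the good event plus `4`, which covers the failure term `4 δ ≤ 4 B` of the
  -- expectation.
  refine ⟨6412, by norm_num, ?_⟩
  intro d K T hd hK hT δ hδ hδ1 C hC rule θ hθ Ω _ P _ X ε hX hε _ hbound hεi hsub hXε
  have hT' : (2 : ℝ) ≤ T := by exact_mod_cast hT
  have hae : ∀ᵐ ω ∂P, ∀ t < T, ∀ i, ‖X t ω i‖ ≤ 1 :=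
    ae_all_iff.mpr fun t => ae_all_iff.mpr fun ht => hbound t ht
  have hF := SupLin.measure_failureSet_le (rule := rule) (θ := θ) (C := C) hd hK hT hδ hδ1 hX hε
    hbound hεi hsub hXε
  have hFm := SupLin.measurableSet_failureSet (δ := δ) (C := C) (rule := rule) (θ := θ) hX hε
  have hB := SupLin.one_le_regret_bound hd hK hT hδ hδ1 hC
  set F := SupLin.failureSet T δ C rule θ X ε
  set B := C * √(d * T) * Real.logb 2 d * Real.logb 2 T * Real.logb 2 (d * K * T / δ)
  refine ⟨?_, ?_, ?_⟩
  · filter_upwards [hae] with ω hω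
    have h1 := SupLin.numSwitches_le T δ C rule θ (fun t => X t ω) (fun t => ε t ω) hd hT
      (by linarith) hω
    have h2 : 0 ≤ d * Real.logb 2 d * Real.logb 2 T / Real.logb 2 C := by
      have e1 := SupLin.one_le_logb_two hd
      have e2 := SupLin.one_le_logb_two hT
      have e3 : 0 < Real.logb 2 C := Real.logb_pos (by norm_num) (by linarith)
      positivity
    linarith
  · set S := {ω | SupLin.regret T δ C rule θ (fun t => X t ω) (fun t => ε t ω) ≤ 6412 * B}
    have h1 : ∀ᵐ ω ∂P, ω ∈ (Set.univ : Set Ω) → ω ∈ S ∪ F := by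
      filter_upwards [hae] with ω hω _
      by_cases hωF : ω ∈ F
      · exact Or.inr hωF
      · refine Or.inl ((SupLin.regret_le_of_notMem_failureSet hd hK hT hδ hδ1 hC hθ hω
          hωF).trans ?_)
        change 6408 * B ≤ 6412 * B
        linarith
    have h2 : 1 ≤ P S + ENNReal.ofReal (2 * δ) := by
      calc 1 = P Set.univ := measure_univ.symm
        _ ≤ P (S ∪ F) := measure_mono_ae h1
        _ ≤ P S + P F := measure_union_le _ _
        _ ≤ _ := by
          gcongr
          refine hF.trans (ENNReal.ofReal_le_ofReal ?_)
          rw [div_le_iff₀ (by linarith)]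
          nlinarith
    rw [ENNReal.ofReal_sub _ (by linarith), ENNReal.ofReal_one]
    exact tsub_le_iff_right.mpr h2
  · refine iSup_le fun A => iSup_le fun _ => iSup_le fun _ => ?_
    -- The event `A` can be dropped: even the integral of the positive part of the regret over all
    -- of `Ω` obeys the bound.
    refine (setLIntegral_le_lintegral A _).trans ?_
    have h1 : ∀ᵐ ω ∂P, ENNReal.ofReal
        (SupLin.regret T δ C rule θ (fun t => X t ω) (fun t => ε t ω)) ≤
        ENNReal.ofReal (6408 * B) + F.indicator (fun _ => ENNReal.ofReal (2 * T)) ω := by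
      filter_upwards [hae] with ω hω
      by_cases hωF : ω ∈ F
      · rw [Set.indicator_of_mem hωF]
        exact (ENNReal.ofReal_le_ofReal (SupLin.regret_le_two_mul T δ C rule θ _ _ hK hθ
          hω)).trans le_add_self
      · rw [Set.indicator_of_notMem hωF, add_zero]
        exact ENNReal.ofReal_le_ofReal
          (SupLin.regret_le_of_notMem_failureSet hd hK hT hδ hδ1 hC hθ hω hωF)
    refine (lintegral_mono_ae h1).trans ?_
    rw [lintegral_add_left measurable_const, lintegral_const, measure_univ, mul_one,
      lintegral_indicator_const hFm]
    calc _ ≤ ENNReal.ofReal (6408 * B) +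
          ENNReal.ofReal (2 * T) * ENNReal.ofReal (2 * δ / T) := by gcongr
      _ = ENNReal.ofReal (6408 * B + 4 * δ) := by
        rw [← ENNReal.ofReal_mul (by positivity),
          ← ENNReal.ofReal_add (by linarith) (by positivity)]
        congr 1
        field_simp
        ring
      _ ≤ _ := ENNReal.ofReal_le_ofReal (by linarith)
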